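/- **Theorem.** Let $P(\lambda)=\sum_{i=0}^dP_i\lambda^i\in\mathbb C[\lambda]^{m\times n}$ have normal rank $r$ (rank over $\mathbb C(\lambda)$). A system matrix $\left[\begin{smallmatrix}A-\lambda E&B\\C&D\end{smallmatrix}\right]$ with regular pencil $A-\lambda E$ *realizes* its transfer function $D+C(\lambda E-A)^{-1}B$. Put $$T(\lambda)=\begin{bmatrix}I_n&-\lambda I_n&&\\&\ddots&\ddots&\\&&I_n&-\lambda I_n\end{bmatrix}\in\mathbb C[\lambda]^{dn\times(d+1)n},\quad A-\lambda E=\begin{bmatrix}T(\lambda)\\ \begin{matrix}0&\cdots&0&I_n\end{matrix}\end{bmatrix},\quad B=\begin{bmatrix}0\\-I_n\end{bmatrix},\quad C=\begin{bmatrix}P_d&\cdots&P_1&P_0\end{bmatrix}.$$ Then $S_P(\lambda)=\left[\begin{smallmatrix}A-\lambda E&B\\C&0\end{smallmatrix}\right]$ realizes $P$. A *staircase decomposition* of $P$ consists of unitary matrices $Q$ (of order $dn$) and $Z$ (of order $(d+1)n$) with $$\begin{bmatrix}Q^*&\\&I_m\end{bmatrix}\begin{bmatrix}T(\lambda)\\C\end{bmatrix}Z=\begin{bmatrix}A_{11}-\lambda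 E_{11}&A_{12}-\lambda E_{12}&A_{13}-\lambda E_{13}&A_{14}-\lambda E_{14}\\0&A_{22}-\lambda E_{22}&A_{23}-\lambda E_{23}&A_{24}-\lambda E_{24}\\0&0&A_{33}-\lambda E_{33}&A_{34}-\lambda E_{34}\\0&0&0&C_4\end{bmatrix}$$ (empty blocks allowed) such that $A_{11}-\lambda E_{11}$ has only right Kronecker blocks, $n-r$ in number (it has full row rank for all $\lambda\in\mathbb C\cup\{\infty\}$, and $n-r$ more columns than rows); $A_{22}-\lambda E_{22}$ is square with $E_{22}$ invertible; $\left[\begin{smallmatrix}A_{33}-\lambda E_{33}&A_{34}-\lambda E_{34}\\0&C_4\end{smallmatrix}\right]$ has only infinite elementary divisors and left Kronecker blocks (it has full column rank for all $\lambda\in\mathbb C$); and $C_4$ has full column rank. A *feedback* for such a decomposition consists of a constant matrix $F\in\mathbb C^{n\times(d+1)n}$ and constant matrices $Z_1,Z_3,Z_4$, with $n-r$, $r$, $r$ rows, such that $$\begin{bmatrix}Q^*&&\\&I_n&\\&&I_m\end{bmatrix}S_P(\lambda)\begin{bmatrix}Z&0\\FZ&I_n\end{bmatrix}=\left[\begin{array}{cccc|cc}A_{11}-\lambda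 E_{11}&A_{12}-\lambda E_{12}&A_{13}-\lambda E_{13}&A_{14}-\lambda E_{14}&0&0\\0&A_{22}-\lambda E_{22}&A_{23}-\lambda E_{23}&A_{24}-\lambda E_{24}&0&0\\0&0&A_{33}-\lambda E_{33}&A_{34}-\lambda E_{34}&0&0\\0&0&Z_3&Z_4&-I_r&0\\Z_1&0&0&0&0&-I_{n-r}\\\hline0&0&0&C_4&0&0\end{array}\right]$$ and $\left[\begin{smallmatrix}A_{11}-\lambda E_{11}\\Z_1\end{smallmatrix}\right]$ and $\left[\begin{smallmatrix}A_{33}-\lambda E_{33}&A_{34}-\lambda E_{34}\\Z_3&Z_4\end{smallmatrix}\right]$ are unimodular (invertible over $\mathbb C[\lambda]$). Then $P$ has a staircase decomposition, every staircase decomposition has a feedback, and for every staircase decomposition and every feedback for it the system matrices $$\left[\begin{array}{cc|c}A_{33}-\lambda E_{33}&A_{34}-\lambda E_{34}&0\\Z_3&Z_4&-I_r\\\hline0&C_4&0\end{array}\right],\qquad\left[\begin{array}{c|c}A-\lambda E&B\\\hline-[I_r\;\,0]F&[I_r\;\,0]\end{array}\right]$$ realize polynomial matrices $N_r\in\mathbb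 C[\lambda]^{m\times r}$ and $G_c\in\mathbb C[\lambda]^{r\times n}$ with the following properties: 1. $P=N_rG_c$; 2. $N_r(\mu)$ has rank $r$ for every $\mu\in\mathbb C$; 3. for every partition of the rows of $P$ into blocks $P_{(1)},\dots,P_{(k)}$, $G_c$ is a compact greatest common right divisor of these blocks: each $P_{(i)}$ is a left polynomial multiple of $G_c$; whenever $D\in\mathbb C[\lambda]^{p\times n}$ is such that each $P_{(i)}$ is a left polynomial multiple of $D$, so is $G_c$; and the number of rows of $G_c$ is the normal rank of $P$; 4. $G_c$ contains all the finite zeros of $P$: $G_c$ and $P$ have the same finite zeros (points $\mu\in\mathbb C$ at which the rank is below the normal rank), with the same multiplicities, that is, monic polynomials $s_1\mid s_2\mid\dots\mid s_r$ are the nonzero diagonal entries of the Smith form of $G_c$ if and only if they are those of the Smith form of $P$. -/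

import Mathlib

open Matrix Polynomial

noncomputable section

/-! ### Polynomial matrices over `ℂ` -/

/-- The rank of a polynomial matrix over the field of rational functions. -/
def normalRank {ι κ : Type*} [Fintype ι] [Fintype κ] (P : Matrix ι κ ℂ[X]) : ℕ :=
  (P.map (algebraMap ℂ[X] (RatFunc ℂ))).rank

/-- The value `P(μ)` of a polynomial matrix at a point `μ`. -/
def evalAt {ι κ : Type*} (P : Matrix ι κ ℂ[X]) (μ : ℂ) : Matrix ι κ ℂ :=
  P.map (Polynomial.eval μ)

/-- A constant matrix, seen as a polynomial matrix. -/
def constPoly {ι κ : Type*} (M : Matrix ι κ ℂ) : Matrix ι κ ℂ[X] :=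
  M.map Polynomial.C

/-- Invertibility over the ring `ℂ[X]`. Rows and columns may be labelled by different types (which
then have the same number of elements). -/
def IsUnimodular {ι κ : Type*} [Fintype ι] [Fintype κ] [DecidableEq ι] [DecidableEq κ]
    (W : Matrix ι κ ℂ[X]) : Prop :=
  ∃ V : Matrix κ ι ℂ[X], W * V = 1 ∧ V * W = 1

/-- The `m × n` matrix with `s 0, …, s (r-1)` on the leading diagonal and zeros elsewhere. -/
def diagRect (m n : ℕ) {r : ℕ} (s : Fin r → ℂ[X]) : Matrix (Fin m) (Fin n) ℂ[X] :=
  Matrix.of fun i j => if h : (i : ℕ) = (j : ℕ) ∧ (i : ℕ) < r then s ⟨i, h.2⟩ else 0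

/-- `s 0 ∣ s 1 ∣ … ∣ s (r-1)` are the (monic) invariant polynomials of `P`: the Smith form of `P`
is `diagRect m n s`. The finite zeros of `P`, with their multiplicities, are those of the
polynomials `s i`. -/
def HasSmithForm {m n r : ℕ} (P : Matrix (Fin m) (Fin n) ℂ[X]) (s : Fin r → ℂ[X]) : Prop :=
  r ≤ m ∧ r ≤ n ∧ (∀ i, (s i).Monic) ∧ (∀ i j, i ≤ j → s i ∣ s j) ∧
    ∃ (U : Matrix (Fin m) (Fin m) ℂ[X]) (V : Matrix (Fin n) (Fin n) ℂ[X]),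
      IsUnimodular U ∧ IsUnimodular V ∧ P = U * diagRect m n s * V

/-- `μ` is a finite zero of `P`: the rank drops at `μ`. -/
def IsFiniteZero {ι κ : Type*} [Fintype ι] [Fintype κ] (P : Matrix ι κ ℂ[X]) (μ : ℂ) : Prop :=
  (evalAt P μ).rank < normalRank P

/-! ### Greatest common right divisors -/

/-- `D` is a common right divisor of the family `P i`. -/
def IsCRD {k n p : ℕ} {ρ : Fin k → Type} (P : ∀ i, Matrix (ρ i) (Fin n) ℂ[X])
    (D : Matrix (Fin p) (Fin n) ℂ[X]) : Prop :=
  ∀ i, ∃ Q : Matrix (ρ i) (Fin p) ℂ[X], P i = Q * D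

/-- `G` is a greatest common right divisor of the family `P i`. -/
def IsGCRD {k n l : ℕ} {ρ : Fin k → Type} (P : ∀ i, Matrix (ρ i) (Fin n) ℂ[X])
    (G : Matrix (Fin l) (Fin n) ℂ[X]) : Prop :=
  IsCRD P G ∧ ∀ (p : ℕ) (D : Matrix (Fin p) (Fin n) ℂ[X]), IsCRD P D →
    ∃ Q : Matrix (Fin l) (Fin p) ℂ[X], G = Q * D

/-- The compound matrix: the blocks `P i` on top of each other. -/
def compound {k n : ℕ} {ρ : Fin k → Type} (P : ∀ i, Matrix (ρ i) (Fin n) ℂ[X]) :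
    Matrix (Σ i, ρ i) (Fin n) ℂ[X] :=
  Matrix.of fun x j => P x.1 x.2 j

/-- A greatest common right divisor whose number of rows is the normal rank of the compound
matrix. -/
def IsCompactGCRD {k n l : ℕ} {ρ : Fin k → Type} [∀ i, Fintype (ρ i)]
    (P : ∀ i, Matrix (ρ i) (Fin n) ℂ[X]) (G : Matrix (Fin l) (Fin n) ℂ[X]) : Prop :=
  IsGCRD P G ∧ normalRank (compound P) = l

/-- The family of row blocks of `P` given by a partition of the rows: the `i`-th block consists of
the rows `a` with `p a = i`. -/
def rowBlocks {m n k : ℕ} (P : Matrix (Fin m) (Fin n) ℂ[X]) (p : Fin m → Fin k) (i : Fin k) :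
    Matrix {a : Fin m // p a = i} (Fin n) ℂ[X] :=
  P.submatrix Subtype.val id

/-! ### Pencils and system matrices -/

/-- The pencil `A - λ E`. -/
def pencil {ι κ : Type*} (A E : Matrix ι κ ℂ) : Matrix ι κ ℂ[X] :=
  constPoly A - (X : ℂ[X]) • constPoly E

/-- The system matrix `[A - λ E, B; C, D]`. -/
def systemMatrix {ι κ ρ σ : Type*} (A E : Matrix ι κ ℂ) (B : Matrix ι σ ℂ) (C : Matrix ρ κ ℂ)
    (D : Matrix ρ σ ℂ) : Matrix (ι ⊕ ρ) (κ ⊕ σ) ℂ[X] :=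
  fromBlocks (pencil A E) (constPoly B) (constPoly C) (constPoly D)

/-- The system matrix `[A - λ E, B; C, D]` is a realization of the polynomial matrix `R`: the pencil
`A - λ E` is regular (with inverse `V` over the rational functions) and `R` is the transfer function
`D + C (λ E - A)⁻¹ B = D - C V B`. -/
def IsRealization {ι κ ρ σ : Type*} [Fintype ι] [Fintype κ] [DecidableEq ι] [DecidableEq κ]
    (A E : Matrix ι κ ℂ) (B : Matrix ι σ ℂ) (C : Matrix ρ κ ℂ) (D : Matrix ρ σ ℂ)
    (R : Matrix ρ σ ℂ[X]) : Prop :=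
  ∃ V : Matrix κ ι (RatFunc ℂ),
    (pencil A E).map (algebraMap ℂ[X] (RatFunc ℂ)) * V = 1 ∧
    V * (pencil A E).map (algebraMap ℂ[X] (RatFunc ℂ)) = 1 ∧
    R.map (algebraMap ℂ[X] (RatFunc ℂ)) =
      D.map (algebraMap ℂ (RatFunc ℂ)) -
        C.map (algebraMap ℂ (RatFunc ℂ)) * V * B.map (algebraMap ℂ (RatFunc ℂ))

/-- The constant part of the first `d` block rows
`[I, -λ I, 0, …, 0], …, [0, …, 0, I, -λ I]` (blocks of size `n`). -/
def topA (n d : ℕ) : Matrix (Fin d × Fin n) (Fin (d + 1) × Fin n) ℂ :=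
  Matrix.of fun i j => if j.1 = i.1.castSucc ∧ j.2 = i.2 then 1 else 0

/-- The coefficient of `-λ` in the first `d` block rows. -/
def topE (n d : ℕ) : Matrix (Fin d × Fin n) (Fin (d + 1) × Fin n) ℂ :=
  Matrix.of fun i j => if j.1 = i.1.succ ∧ j.2 = i.2 then 1 else 0

/-- The block row `[0, …, 0, I]`. -/
def lastRow (n d : ℕ) : Matrix (Fin n) (Fin (d + 1) × Fin n) ℂ :=
  Matrix.of fun i j => if j.1 = Fin.last d ∧ j.2 = i then 1 else 0

/-- The block row `[P_d, …, P_1, P_0]` of the coefficients of `P`. -/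
def coeffRow {m n : ℕ} (d : ℕ) (P : Matrix (Fin m) (Fin n) ℂ[X]) :
    Matrix (Fin m) (Fin (d + 1) × Fin n) ℂ :=
  Matrix.of fun i j => (P i j.2).coeff (d - (j.1 : ℕ))

/-- `A` in the system matrix of `P`: the identity, its rows split into the first `d` block rows and
the last one. -/
def sysA (n d : ℕ) : Matrix ((Fin d × Fin n) ⊕ Fin n) (Fin (d + 1) × Fin n) ℂ :=
  fromRows (topA n d) (lastRow n d)

/-- `E` in the system matrix of `P`. -/
def sysE (n d : ℕ) : Matrix ((Fin d × Fin n) ⊕ Fin n) (Fin (d + 1) × Fin n) ℂ :=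
  fromRows (topE n d) 0

/-- `B` in the system matrix of `P`. -/
def sysB (n d : ℕ) : Matrix ((Fin d × Fin n) ⊕ Fin n) (Fin n) ℂ :=
  fromRows 0 (-1)

/-- The subpencil of the system matrix without its last block column and its block row
`[0, …, 0, I]`. -/
def subPencil {m n : ℕ} (d : ℕ) (P : Matrix (Fin m) (Fin n) ℂ[X]) :
    Matrix ((Fin d × Fin n) ⊕ Fin m) (Fin (d + 1) × Fin n) ℂ[X] :=
  fromRows (pencil (topA n d) (topE n d)) (constPoly (coeffRow d P))

/-! ### The staircase decomposition -/

/-- Full row rank. -/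
def FullRowRank {ι κ : Type*} [Fintype ι] [Fintype κ] (M : Matrix ι κ ℂ) : Prop :=
  M.rank = Fintype.card ι

/-- Full column rank. -/
def FullColRank {ι κ : Type*} [Fintype ι] [Fintype κ] (M : Matrix ι κ ℂ) : Prop :=
  M.rank = Fintype.card κ

/-- The pencil has right Kronecker blocks only: it has full row rank at every point of `ℂ ∪ {∞}`.
The number of these blocks is the number of columns minus the number of rows. -/
def OnlyRightKronecker {ι κ : Type*} [Fintype ι] [Fintype κ] (A E : Matrix ι κ ℂ) : Prop :=
  (∀ μ : ℂ, FullRowRank (A - μ • E)) ∧ FullRowRank E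

/-- The pencil has infinite elementary divisors and left Kronecker blocks only: it has full column
rank at every point of `ℂ`. -/
def OnlyInfiniteAndLeftKronecker {ι κ : Type*} [Fintype ι] [Fintype κ]
    (A E : Matrix ι κ ℂ) : Prop :=
  ∀ μ : ℂ, FullColRank (A - μ • E)

/-- The block sizes, transformations and blocks of a staircase decomposition. The block rows have
sizes `a₁, a₂, a₃`, the block columns `b₁, a₂, b₃, b₄`; the columns of the transformations `Q` and
`Z` are partitioned accordingly. -/
structure Staircase (m n d : ℕ) where
  (a₁ a₂ a₃ b₁ b₃ b₄ : ℕ)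
  Q : Matrix (Fin d × Fin n) (Fin a₁ ⊕ Fin a₂ ⊕ Fin a₃) ℂ
  Z : Matrix (Fin (d + 1) × Fin n) (Fin b₁ ⊕ Fin a₂ ⊕ Fin b₃ ⊕ Fin b₄) ℂ
  (A₁₁ E₁₁ : Matrix (Fin a₁) (Fin b₁) ℂ)
  (A₁₂ E₁₂ : Matrix (Fin a₁) (Fin a₂) ℂ)
  (A₁₃ E₁₃ : Matrix (Fin a₁) (Fin b₃) ℂ)
  (A₁₄ E₁₄ : Matrix (Fin a₁) (Fin b₄) ℂ)
  (A₂₂ E₂₂ : Matrix (Fin a₂) (Fin a₂) ℂ)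
  (A₂₃ E₂₃ : Matrix (Fin a₂) (Fin b₃) ℂ)
  (A₂₄ E₂₄ : Matrix (Fin a₂) (Fin b₄) ℂ)
  (A₃₃ E₃₃ : Matrix (Fin a₃) (Fin b₃) ℂ)
  (A₃₄ E₃₄ : Matrix (Fin a₃) (Fin b₄) ℂ)
  C₄ : Matrix (Fin m) (Fin b₄) ℂ

namespace Staircase

variable {m n d : ℕ} (S : Staircase m n d)

/-- The three upper block rows of the staircase form. -/
def top : Matrix (Fin S.a₁ ⊕ Fin S.a₂ ⊕ Fin S.a₃) (Fin S.b₁ ⊕ Fin S.a₂ ⊕ Fin S.b₃ ⊕ Fin S.b₄) ℂ[X] :=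
  fromRows
    (fromCols (pencil S.A₁₁ S.E₁₁) (fromCols (pencil S.A₁₂ S.E₁₂)
      (fromCols (pencil S.A₁₃ S.E₁₃) (pencil S.A₁₄ S.E₁₄))))
    (fromRows
      (fromCols 0 (fromCols (pencil S.A₂₂ S.E₂₂)
        (fromCols (pencil S.A₂₃ S.E₂₃) (pencil S.A₂₄ S.E₂₄))))
      (fromCols 0 (fromCols 0
        (fromCols (pencil S.A₃₃ S.E₃₃) (pencil S.A₃₄ S.E₃₄)))))

/-- The lowest block row `[0, 0, 0, C₄]` of the staircase form. -/
def bottom : Matrix (Fin m) (Fin S.b₁ ⊕ Fin S.a₂ ⊕ Fin S.b₃ ⊕ Fin S.b₄) ℂ :=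
  fromCols 0 (fromCols 0 (fromCols 0 S.C₄))

/-- The left transformation `diag(Q*, I_l)`. -/
def leftQ (l : ℕ) :
    Matrix ((Fin S.a₁ ⊕ Fin S.a₂ ⊕ Fin S.a₃) ⊕ Fin l) ((Fin d × Fin n) ⊕ Fin l) ℂ :=
  fromBlocks S.Qᴴ 0 0 1

/-- `S` is a staircase decomposition for the polynomial matrix `P` of normal rank `r`. -/
structure IsDecomposition (P : Matrix (Fin m) (Fin n) ℂ[X]) (r : ℕ) : Prop where
  unitaryQ : S.Qᴴ * S.Q = 1 ∧ S.Q * S.Qᴴ = 1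
  unitaryZ : S.Zᴴ * S.Z = 1 ∧ S.Z * S.Zᴴ = 1
  /-- `diag(Q*, I) * subPencil * Z` is the staircase form. -/
  form : constPoly (S.leftQ m) * subPencil d P * constPoly S.Z =
    fromRows S.top (constPoly S.bottom)
  /-- `A₁₁ - λ E₁₁` consists of right Kronecker blocks. -/
  right : OnlyRightKronecker S.A₁₁ S.E₁₁
  /-- There are `n - r` right Kronecker blocks. -/
  right_count : S.b₁ + r = S.a₁ + n
  /-- `A₂₂ - λ E₂₂` is regular, with finite eigenvalues only. As the diagonal blocks before and
  after it have no finite zeros, its eigenvalues are the finite zeros of the whole pencil. -/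
  finite : IsUnit S.E₂₂.det
  /-- `[A₃₃ - λ E₃₃, A₃₄ - λ E₃₄; 0, C₄]` consists of the infinite elementary divisors and left
  Kronecker blocks. -/
  left : OnlyInfiniteAndLeftKronecker
    (fromBlocks S.A₃₃ S.A₃₄ 0 S.C₄) (fromBlocks S.E₃₃ S.E₃₄ 0 0)
  fullC₄ : FullColRank S.C₄

end Staircase

/-! ### The feedback -/

/-- The matrix with `n` rows of which the first `r` are those of `T` and the last `n - r` those
of `B`. -/
def stackRows {n r : ℕ} {κ R : Type*} (T : Matrix (Fin r) κ R) (B : Matrix (Fin (n - r)) κ R) :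
    Matrix (Fin n) κ R :=
  Matrix.of fun i j =>
    if h : (i : ℕ) < r then T ⟨i, h⟩ j else B ⟨(i : ℕ) - r, by omega⟩ j

/-- The `r × n` matrix `[I_r, 0]`. -/
def selRow (r n : ℕ) : Matrix (Fin r) (Fin n) ℂ :=
  Matrix.of fun i j => if (i : ℕ) = (j : ℕ) then 1 else 0

namespace Staircase

variable {m n d : ℕ} (S : Staircase m n d)

/-- A feedback `F` together with the constant matrices `Z₁, Z₃, Z₄` that it places in the last
block rows of the state pencil. -/
structure Feedback (r : ℕ) where
  Z₁ : Matrix (Fin (n - r)) (Fin S.b₁) ℂ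
  Z₃ : Matrix (Fin r) (Fin S.b₃) ℂ
  Z₄ : Matrix (Fin r) (Fin S.b₄) ℂ
  F : Matrix (Fin n) (Fin (d + 1) × Fin n) ℂ

variable {S} {r : ℕ} (K : S.Feedback r)

/-- The block rows `[0, 0, Z₃, Z₄; Z₁, 0, 0, 0]`. -/
def Feedback.rows : Matrix (Fin n) (Fin S.b₁ ⊕ Fin S.a₂ ⊕ Fin S.b₃ ⊕ Fin S.b₄) ℂ :=
  stackRows (fromCols 0 (fromCols 0 (fromCols K.Z₃ K.Z₄)))
    (fromCols K.Z₁ (fromCols 0 (fromCols 0 0)))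

/-- The left transformation `diag(Q*, I_n, I_m)` of the whole system matrix. -/
def sysLeft (S : Staircase m n d) :
    Matrix (((Fin S.a₁ ⊕ Fin S.a₂ ⊕ Fin S.a₃) ⊕ Fin n) ⊕ Fin m)
      (((Fin d × Fin n) ⊕ Fin n) ⊕ Fin m) ℂ :=
  fromBlocks (S.leftQ n) 0 0 1

/-- The right transformation `[Z, 0; F Z, I_n]` of the whole system matrix. -/
def Feedback.sysRight : Matrix ((Fin (d + 1) × Fin n) ⊕ Fin n)
    ((Fin S.b₁ ⊕ Fin S.a₂ ⊕ Fin S.b₃ ⊕ Fin S.b₄) ⊕ Fin n) ℂ :=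
  fromBlocks S.Z 0 (K.F * S.Z) 1

/-- `F` transforms the system matrix of `P` as required, and the two embeddings are unimodular. -/
structure Feedback.IsEmbedding (P : Matrix (Fin m) (Fin n) ℂ[X]) : Prop where
  /-- `diag(Q*, I_n, I_m) * S_P * [Z, 0; F Z, I_n]` is the staircase form of `S_P`. -/
  form :
    constPoly S.sysLeft *
        systemMatrix (sysA n d) (sysE n d) (sysB n d) (coeffRow d P) 0 * constPoly K.sysRight =
      fromBlocks (fromRows S.top (constPoly K.rows)) (fromRows 0 (-1)) (constPoly S.bottom) 0
  unimodular₁ : IsUnimodular (fromRows (pencil S.A₁₁ S.E₁₁) (constPoly K.Z₁))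
  unimodular₃ : IsUnimodular
    (fromBlocks (pencil S.A₃₃ S.E₃₃) (pencil S.A₃₄ S.E₃₄) (constPoly K.Z₃) (constPoly K.Z₄))

/-- The system matrix `[A₃₃ - λ E₃₃, A₃₄ - λ E₃₄, 0; Z₃, Z₄, -I_r; 0, C₄, 0]` is a realization
of `N`. -/
def Feedback.RealizesLeft (N : Matrix (Fin m) (Fin r) ℂ[X]) : Prop :=
  IsRealization (fromBlocks S.A₃₃ S.A₃₄ K.Z₃ K.Z₄) (fromBlocks S.E₃₃ S.E₃₄ 0 0)
    (fromRows 0 (-1)) (fromCols 0 S.C₄) 0 N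

/-- The system matrix `[A - λ E, B; -[I_r, 0] F, [I_r, 0]]` is a realization of `G`. -/
def Feedback.RealizesRight (G : Matrix (Fin r) (Fin n) ℂ[X]) : Prop :=
  IsRealization (sysA n d) (sysE n d) (sysB n d) (-(selRow r n * K.F)) (selRow r n) G

end Staircase

end

/-! The block column `Λ = [λ^d I; …; λ I; I]` of monomials satisfies `T Λ = 0`, `[0, …, 0, I] Λ = I`
and `[P_d, …, P_0] Λ = P`, and the state pencil has an explicit polynomial inverse whose last block
column is `Λ` (`pencil_sys_mul_inverse`). Hence every system with this state pencil and input matrix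
has the transfer function `D + C Λ` (`isRealization_sys`).

*Staircase form.* Write `T = A - λ E` and `C = [P_d, …, P_0]`. On `K = ker C` take a maximal
subspace `X₂` with `A X₂ ≤ E X₂`, and in it a minimal
`X₁` containing `ker E ⊓ X₂` with `A X₁ ≤ E X₁` (`exists_deflating_subspaces`). Extremality alone gives
the rank conditions on the diagonal blocks. Unitary matrices adapted to the flags `X₁ ≤ X₂ ≤ K` and
`E X₁ ≤ E X₂` give the block form, and comparing null spaces over the rational functions counts the
right Kronecker blocks (`Staircase.right_count_eq`).

*Feedback.* The condition on `F` reads `([0, …, 0, I] - F) Z = [0, 0, Z₃, Z₄; Z₁, 0, 0, 0]`, which can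
be solved for `F` as `Z` is unitary. What remains is to complete a pencil `A - λ E` with full row rank
at every point to a unimodular one by constant rows. This follows from a section `s` of `A` with `E s`
nilpotent (`exists_nilpotent_section`, `exists_unimodular_completion`).

*Factorization.* Let `Y` be the last two blocks of `Λ` in the coordinates of `Z`. Then `W Y = [0; G]` and
`[0, C₄] Y = P`, where `W` is the unimodular embedding of the last diagonal block. So `P = N G` with
`N = [0, C₄] W⁻¹ [0; I]`. By the local–global principle `exists_left_inverse`, the pencil with left
Kronecker blocks only has a polynomial left inverse, and `N` inherits one (`exists_factorization`).
All remaining properties are formal consequences of `P = N G` and `L N = 1`; the comparison of Smith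
forms does not need their uniqueness (`hasSmithForm_iff_of_left_inverse`). -/

noncomputable section

/-! ### Constant matrices, pencils and evaluation -/

section Basic

variable {ι κ ρ σ : Type*}

theorem constPoly_mul [Fintype κ] (M : Matrix ι κ ℂ) (N : Matrix κ ρ ℂ) :
    constPoly (M * N) = constPoly M * constPoly N :=
  Matrix.map_mul (f := Polynomial.C)

theorem constPoly_one [DecidableEq ι] : constPoly (1 : Matrix ι ι ℂ) = 1 := by
  simp [constPoly]

theorem constPoly_zero : constPoly (0 : Matrix ι κ ℂ) = 0 := by
  simp [constPoly]

theorem constPoly_neg (M : Matrix ι κ ℂ) : constPoly (-M) = -constPoly M := by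
  ext; simp [constPoly]

theorem constPoly_injective : Function.Injective (constPoly : Matrix ι κ ℂ → Matrix ι κ ℂ[X]) :=
  fun M N h => by
    ext i j
    simpa [constPoly] using congrFun (congrFun h i) j

theorem constPoly_fromRows (M : Matrix ι κ ℂ) (N : Matrix ρ κ ℂ) :
    constPoly (fromRows M N) = fromRows (constPoly M) (constPoly N) :=
  Matrix.fromRows_map M N _

theorem constPoly_fromCols (M : Matrix ι κ ℂ) (N : Matrix ι ρ ℂ) :
    constPoly (fromCols M N) = fromCols (constPoly M) (constPoly N) := by
  ext i (j | j) <;> rfl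

theorem constPoly_fromBlocks (A : Matrix ι κ ℂ) (B : Matrix ι σ ℂ) (C : Matrix ρ κ ℂ)
    (D : Matrix ρ σ ℂ) : constPoly (fromBlocks A B C D) =
      fromBlocks (constPoly A) (constPoly B) (constPoly C) (constPoly D) :=
  Matrix.fromBlocks_map _ _ _ _ _

theorem constPoly_map_algebraMap (M : Matrix ι κ ℂ) :
    (constPoly M).map (algebraMap ℂ[X] (RatFunc ℂ)) = M.map (algebraMap ℂ (RatFunc ℂ)) := by
  ext i j
  simp only [constPoly, Matrix.map_apply, ← Polynomial.algebraMap_eq]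
  rw [← IsScalarTower.algebraMap_apply ℂ ℂ[X] (RatFunc ℂ)]

theorem pencil_apply (A E : Matrix ι κ ℂ) (i : ι) (j : κ) :
    pencil A E i j = C (A i j) - X * C (E i j) := by
  simp [pencil, constPoly]

theorem pencil_zero_right (A : Matrix ι κ ℂ) : pencil A 0 = constPoly A := by
  simp [pencil, constPoly_zero]

theorem mul_pencil [Fintype ι] (M : Matrix ρ ι ℂ) (A E : Matrix ι κ ℂ) :
    constPoly M * pencil A E = pencil (M * A) (M * E) := by
  simp [pencil, constPoly_mul, Matrix.mul_sub]

theorem pencil_mul [Fintype κ] (A E : Matrix ι κ ℂ) (M : Matrix κ ρ ℂ) :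
    pencil A E * constPoly M = pencil (A * M) (E * M) := by
  simp [pencil, constPoly_mul, Matrix.sub_mul]

theorem pencil_fromRows (A E : Matrix ι κ ℂ) (A' E' : Matrix ρ κ ℂ) :
    pencil (fromRows A A') (fromRows E E') = fromRows (pencil A E) (pencil A' E') := by
  ext (i | i) j <;> simp [pencil_apply]

theorem pencil_fromCols (A E : Matrix ι κ ℂ) (A' E' : Matrix ι ρ ℂ) :
    pencil (fromCols A A') (fromCols E E') = fromCols (pencil A E) (pencil A' E') := by
  ext i (j | j) <;> simp [pencil_apply]

theorem pencil_fromBlocks (A E : Matrix ι κ ℂ) (A' E' : Matrix ι σ ℂ) (A'' E'' : Matrix ρ κ ℂ)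
    (A''' E''' : Matrix ρ σ ℂ) :
    pencil (fromBlocks A A' A'' A''') (fromBlocks E E' E'' E''') =
      fromBlocks (pencil A E) (pencil A' E') (pencil A'' E'') (pencil A''' E''') := by
  ext (i | i) (j | j) <;> simp [pencil_apply]

theorem evalAt_mul [Fintype κ] (M : Matrix ι κ ℂ[X]) (N : Matrix κ ρ ℂ[X]) (μ : ℂ) :
    evalAt (M * N) μ = evalAt M μ * evalAt N μ :=
  Matrix.map_mul (f := Polynomial.evalRingHom μ)

theorem evalAt_one [DecidableEq ι] (μ : ℂ) : evalAt (1 : Matrix ι ι ℂ[X]) μ = 1 :=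
  Matrix.map_one (Polynomial.evalRingHom μ) (map_zero _) (map_one _)

theorem evalAt_constPoly (M : Matrix ι κ ℂ) (μ : ℂ) : evalAt (constPoly M) μ = M := by
  ext; simp [evalAt, constPoly]

theorem evalAt_pencil (A E : Matrix ι κ ℂ) (μ : ℂ) : evalAt (pencil A E) μ = A - μ • E := by
  ext
  simp only [evalAt, Matrix.map_apply, pencil_apply, eval_sub, eval_mul, eval_X, eval_C,
    Matrix.sub_apply, Matrix.smul_apply, smul_eq_mul]

theorem evalAt_fromCols (M : Matrix ι κ ℂ[X]) (N : Matrix ι ρ ℂ[X]) (μ : ℂ) :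
    evalAt (fromCols M N) μ = fromCols (evalAt M μ) (evalAt N μ) := by
  ext i (j | j) <;> rfl

end Basic

/-! ### Rank, kernels and one-sided inverses -/

section Rank

variable {ι κ ρ : Type*} [Fintype ι] [Fintype κ] [Fintype ρ]

theorem Matrix.rank_eq_card_cols_iff {ι : Type*} {K : Type*} [Field K] (M : Matrix ι κ K) :
    M.rank = Fintype.card κ ↔ ∀ v, M *ᵥ v = 0 → v = 0 := by
  have h := LinearMap.finrank_range_add_finrank_ker M.mulVecLin
  rw [Module.finrank_fintype_fun_eq_card] at h
  have h0 : (∀ v, M *ᵥ v = 0 → v = 0) ↔ LinearMap.ker M.mulVecLin = ⊥ := by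
    rw [LinearMap.ker_eq_bot']; rfl
  rw [h0, Matrix.rank, ← Submodule.finrank_eq_zero (R := K)]
  omega

theorem Matrix.rank_eq_card_rows_iff {K : Type*} [Field K] (M : Matrix ι κ K) :
    M.rank = Fintype.card ι ↔ ∀ w, ∃ v, M *ᵥ v = w := by
  have h0 : (∀ w, ∃ v, M *ᵥ v = w) ↔ LinearMap.range M.mulVecLin = ⊤ := by
    rw [LinearMap.range_eq_top]; rfl
  rw [h0, Matrix.rank, ← Module.finrank_fintype_fun_eq_card (R := K) (η := ι)]
  exact ⟨Submodule.eq_top_of_finrank_eq, fun h => by rw [h, finrank_top]⟩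

theorem fullColRank_iff (M : Matrix ι κ ℂ) : FullColRank M ↔ ∀ v, M *ᵥ v = 0 → v = 0 :=
  M.rank_eq_card_cols_iff

theorem fullRowRank_iff (M : Matrix ι κ ℂ) : FullRowRank M ↔ ∀ w, ∃ v, M *ᵥ v = w :=
  M.rank_eq_card_rows_iff

theorem fullRowRank_transpose (M : Matrix ι κ ℂ) : FullRowRank Mᵀ ↔ FullColRank M := by
  rw [FullRowRank, FullColRank, Matrix.rank_transpose]

theorem Matrix.rank_mul_of_left_inverse [DecidableEq κ] {K : Type*} [Field K]
    {L : Matrix κ ι K} {N : Matrix ι κ K} (h : L * N = 1) (M : Matrix κ ρ K) :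
    (N * M).rank = M.rank := by
  refine le_antisymm (Matrix.rank_mul_le_right _ _) ?_
  calc M.rank = (L * (N * M)).rank := by rw [← Matrix.mul_assoc, h, Matrix.one_mul]
    _ ≤ (N * M).rank := Matrix.rank_mul_le_right _ _

theorem normalRank_mul_of_left_inverse [DecidableEq κ] {L : Matrix κ ι ℂ[X]} {N : Matrix ι κ ℂ[X]}
    (h : L * N = 1) (M : Matrix κ ρ ℂ[X]) : normalRank (N * M) = normalRank M := by
  have h' := congrArg (fun Y => Y.map (algebraMap ℂ[X] (RatFunc ℂ))) h
  simp only [Matrix.map_mul] at h'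
  rw [Matrix.map_one _ (map_zero _) (map_one _)] at h'
  rw [normalRank, normalRank, Matrix.map_mul]
  exact Matrix.rank_mul_of_left_inverse h' _

/-- Local–global principle: a polynomial matrix with full column rank at every point has a
polynomial left inverse. Otherwise the row module would lie in a maximal submodule, which contains
`(X - μ) • v` for some `μ` and all `v`; but modulo `X - μ` the rows span everything. -/
theorem exists_left_inverse [DecidableEq κ] {M : Matrix ι κ ℂ[X]}
    (h : ∀ μ, FullColRank (evalAt M μ)) : ∃ L : Matrix κ ι ℂ[X], L * M = 1 := by
  have key : LinearMap.range M.vecMulLinear = ⊤ := by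
    by_contra hne
    obtain ⟨N, hN, hle⟩ := (eq_top_or_exists_le_coatom (LinearMap.range M.vecMulLinear)).resolve_left
      hne
    have : IsSimpleModule ℂ[X] ((κ → ℂ[X]) ⧸ N) := isSimpleModule_iff_isCoatom.2 hN
    have hI := IsSimpleModule.annihilator_isMaximal (R := ℂ[X]) (M := (κ → ℂ[X]) ⧸ N)
    set I := Module.annihilator ℂ[X] ((κ → ℂ[X]) ⧸ N)
    obtain ⟨p, hp⟩ := (IsPrincipalIdealRing.principal I).principal
    have hp0 : p ≠ 0 := by
      rintro rfl
      refine Ring.ne_bot_of_isMaximal_of_not_isField hI (Polynomial.not_isField ℂ) ?_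
      simpa using hp
    have hdeg : p.degree ≠ 0 := by
      intro hd
      refine hI.ne_top ?_
      rw [hp]
      exact Ideal.span_singleton_eq_top.2 (Polynomial.isUnit_iff_degree_eq_zero.2 hd)
    obtain ⟨μ, hμ⟩ := IsAlgClosed.exists_root p hdeg
    have hle' : I ≤ Ideal.span {X - C μ} := by
      rw [hp]
      exact Ideal.span_singleton_le_span_singleton.2 (Polynomial.dvd_iff_isRoot.2 hμ)
    have hmem : (X - C μ : ℂ[X]) ∈ I := by
      rw [hI.eq_of_le ?_ hle']
      · exact Ideal.mem_span_singleton_self _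
      · rw [Ne, Ideal.span_singleton_eq_top]
        exact Polynomial.not_isUnit_X_sub_C μ
    have hN' : ∀ f : κ → ℂ[X], (∀ k, (f k).eval μ = 0) → f ∈ N := by
      intro f hf
      choose g hg using fun k => Polynomial.dvd_iff_isRoot.2 (hf k)
      have : f = (X - C μ : ℂ[X]) • g := by ext1 k; simp [hg k]
      rw [this, ← Submodule.Quotient.mk_eq_zero, Submodule.Quotient.mk_smul]
      exact Module.mem_annihilator.1 hmem _
    refine hN.1 (eq_top_iff.2 fun f _ => ?_)
    obtain ⟨w, hw⟩ := (fullRowRank_iff _).1 ((fullRowRank_transpose _).2 (h μ))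
      (fun k => (f k).eval μ)
    have h1 : M.vecMulLinear (fun i => C (w i)) ∈ N := hle ⟨_, rfl⟩
    have h2 : f - M.vecMulLinear (fun i => C (w i)) ∈ N := by
      refine hN' _ fun k => ?_
      have := congrFun hw k
      simp only [Matrix.mulVec, dotProduct, Matrix.transpose_apply, evalAt, Matrix.map_apply] at this
      simp [Matrix.vecMul, dotProduct, eval_finsetSum, ← this, mul_comm]
    simpa using N.add_mem h2 h1
  choose L hL using fun k => LinearMap.range_eq_top.1 key (Pi.single k 1)
  refine ⟨Matrix.of L, ?_⟩
  ext k l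
  have := congrFun (hL k) l
  simp only [Matrix.vecMulLinear_apply] at this
  rw [Matrix.one_eq_pi_single, ← this]
  rfl

theorem exists_right_inverse [DecidableEq ι] {M : Matrix ι κ ℂ[X]}
    (h : ∀ μ, FullRowRank (evalAt M μ)) : ∃ L : Matrix κ ι ℂ[X], M * L = 1 := by
  obtain ⟨L, hL⟩ := exists_left_inverse (M := Mᵀ) fun μ => by
    rw [← fullRowRank_transpose]
    exact h μ
  exact ⟨Lᵀ, by rw [← Matrix.transpose_inj, Matrix.transpose_mul, Matrix.transpose_transpose, hL,
    Matrix.transpose_one]⟩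

end Rank

/-! ### The linearization of a polynomial matrix -/

section System

variable {ι κ ρ σ : Type*} [Fintype ι] [Fintype κ] [DecidableEq ι] [DecidableEq κ]

/-- A system matrix whose state pencil is unimodular realizes a polynomial matrix. -/
theorem isRealization_of_inverse {A E : Matrix ι κ ℂ} {B : Matrix ι σ ℂ} {C : Matrix ρ κ ℂ}
    {D : Matrix ρ σ ℂ} {V : Matrix κ ι ℂ[X]} (h₁ : pencil A E * V = 1) (h₂ : V * pencil A E = 1) :
    IsRealization A E B C D (constPoly D - constPoly C * V * constPoly B) := by
  refine ⟨V.map (algebraMap ℂ[X] (RatFunc ℂ)), ?_, ?_, ?_⟩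
  · rw [← Matrix.map_mul, h₁, Matrix.map_one _ (map_zero _) (map_one _)]
  · rw [← Matrix.map_mul, h₂, Matrix.map_one _ (map_zero _) (map_one _)]
  · rw [Matrix.map_sub _ (fun a b => map_sub _ a b), Matrix.map_mul, Matrix.map_mul]
    simp only [constPoly_map_algebraMap]

/-- The block column `[λ^d I; …; λ I; I]` of monomials. -/
def monomialCol (n d : ℕ) : Matrix (Fin (d + 1) × Fin n) (Fin n) ℂ[X] :=
  Matrix.of fun j b => if j.2 = b then X ^ (d - (j.1 : ℕ)) else 0

/-- The first `d` block columns of the inverse of the state pencil: the block in position `(j, k)`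
is `λ^(k - j) I` for `j ≤ k`. -/
def sysInvLeft (n d : ℕ) : Matrix (Fin (d + 1) × Fin n) (Fin d × Fin n) ℂ[X] :=
  Matrix.of fun j k =>
    if j.2 = k.2 ∧ (j.1 : ℕ) ≤ k.1 then X ^ ((k.1 : ℕ) - (j.1 : ℕ)) else 0

variable {n d : ℕ}

theorem topPencil_mul_apply (M : Matrix (Fin (d + 1) × Fin n) ρ ℂ[X]) (i : Fin d × Fin n) (x : ρ) :
    (pencil (topA n d) (topE n d) * M) i x =
      M (i.1.castSucc, i.2) x - X * M (i.1.succ, i.2) x := by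
  simp only [Matrix.mul_apply, pencil_apply, sub_mul, Finset.sum_sub_distrib, topA, topE,
    Matrix.of_apply]
  congr 1
  · rw [Finset.sum_eq_single (i.1.castSucc, i.2)]
    · simp
    · rintro ⟨b, c⟩ - hb
      have : ¬ (b = i.1.castSucc ∧ c = i.2) := fun h => hb (by rw [h.1, h.2])
      simp [this]
    · simp
  · rw [Finset.sum_eq_single (i.1.succ, i.2)]
    · simp
    · rintro ⟨b, c⟩ - hb
      have : ¬ (b = i.1.succ ∧ c = i.2) := fun h => hb (by rw [h.1, h.2])
      simp [this]
    · simp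

theorem lastRow_mul_apply (M : Matrix (Fin (d + 1) × Fin n) ρ ℂ[X]) (i : Fin n) (x : ρ) :
    (constPoly (lastRow n d) * M) i x = M (Fin.last d, i) x := by
  simp only [Matrix.mul_apply, constPoly, Matrix.map_apply, lastRow, Matrix.of_apply]
  rw [Finset.sum_eq_single (Fin.last d, i)]
  · simp
  · rintro ⟨b, c⟩ - hb
    have : ¬ (b = Fin.last d ∧ c = i) := fun h => hb (by rw [h.1, h.2])
    simp [this]
  · simp

theorem topPencil_mul_monomialCol :
    pencil (topA n d) (topE n d) * monomialCol n d = 0 := by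
  ext1 i b
  rw [topPencil_mul_apply]
  simp only [monomialCol, Matrix.of_apply, Fin.val_castSucc, Fin.val_succ, Matrix.zero_apply]
  split_ifs
  · rw [← pow_succ', sub_eq_zero]
    congr 1
    omega
  · simp

theorem lastRow_mul_monomialCol : constPoly (lastRow n d) * monomialCol n d = 1 := by
  ext1 i b
  rw [lastRow_mul_apply]
  simp [monomialCol, Matrix.one_apply]

theorem topPencil_mul_sysInvLeft : pencil (topA n d) (topE n d) * sysInvLeft n d = 1 := by
  ext1 i k
  rw [topPencil_mul_apply]
  simp only [sysInvLeft, Matrix.of_apply, Fin.val_castSucc, Fin.val_succ, Matrix.one_apply,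
    Prod.ext_iff, Fin.ext_iff]
  by_cases h : (i.2 : ℕ) = k.2
  · rcases lt_trichotomy (i.1 : ℕ) (k.1 : ℕ) with h' | h' | h'
    · have h1 : (i.1 : ℕ) + 1 ≤ k.1 := h'
      have h2 : (i.1 : ℕ) ≠ k.1 := h'.ne
      simp only [h, h1, h'.le, h2, and_self, if_true, false_and, if_false]
      rw [← pow_succ', sub_eq_zero]
      congr 1
      omega
    · simp [h, h']
    · have h1 : ¬ (i.1 : ℕ) ≤ k.1 := by omega
      have h2 : ¬ (i.1 : ℕ) + 1 ≤ k.1 := by omega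
      have h3 : (i.1 : ℕ) ≠ k.1 := h'.ne'
      simp [h1, h2, h3]
  · simp [h]

theorem lastRow_mul_sysInvLeft : constPoly (lastRow n d) * sysInvLeft n d = 0 := by
  ext1 i k
  rw [lastRow_mul_apply]
  have h2 : ¬ d ≤ (k.1 : ℕ) := by omega
  simp [sysInvLeft, h2]

theorem coeffRow_mul_monomialCol {m : ℕ} {P : Matrix (Fin m) (Fin n) ℂ[X]}
    (hd : ∀ i j, (P i j).natDegree ≤ d) : constPoly (coeffRow d P) * monomialCol n d = P := by
  ext1 i b
  simp only [Matrix.mul_apply, constPoly, Matrix.map_apply, coeffRow, Matrix.of_apply, monomialCol,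
    Fintype.sum_prod_type, mul_ite, mul_zero, Finset.sum_ite_eq', Finset.mem_univ, if_true]
  refine (Finset.sum_range fun j => C ((P i b).coeff (d - j)) * X ^ (d - j)).symm.trans ?_
  refine Eq.trans ?_ ((P i b).as_sum_range_C_mul_X_pow' (Nat.lt_succ_of_le (hd i b))).symm
  rw [← Finset.sum_range_reflect (fun j => C ((P i b).coeff j) * X ^ j) (d + 1)]
  exact Finset.sum_congr rfl fun j _ => by rw [Nat.add_sub_cancel]

theorem pencil_sys : pencil (sysA n d) (sysE n d) =
    fromRows (pencil (topA n d) (topE n d)) (constPoly (lastRow n d)) := by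
  rw [sysA, sysE, pencil_fromRows, pencil_zero_right]

theorem pencil_sys_mul_inverse :
    pencil (sysA n d) (sysE n d) * fromCols (sysInvLeft n d) (monomialCol n d) = 1 := by
  rw [pencil_sys, Matrix.fromRows_mul_fromCols, topPencil_mul_sysInvLeft, topPencil_mul_monomialCol,
    lastRow_mul_sysInvLeft, lastRow_mul_monomialCol, Matrix.fromBlocks_one]

theorem inverse_mul_pencil_sys :
    fromCols (sysInvLeft n d) (monomialCol n d) * pencil (sysA n d) (sysE n d) = 1 :=
  (Matrix.mul_eq_one_comm_of_card_eq _ _ _ (by simp [add_mul])).1 pencil_sys_mul_inverse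

/-- The transfer function of a system with the state pencil and input matrix of the linearization
is obtained from the block column of monomials. -/
theorem isRealization_sys (C : Matrix ρ (Fin (d + 1) × Fin n) ℂ) (D : Matrix ρ (Fin n) ℂ) :
    IsRealization (sysA n d) (sysE n d) (sysB n d) C D
      (constPoly D + constPoly C * monomialCol n d) := by
  have h := isRealization_of_inverse (B := sysB n d) (C := C) (D := D)
    (pencil_sys_mul_inverse (n := n) (d := d)) inverse_mul_pencil_sys
  convert h using 1
  rw [sysB, constPoly_fromRows, Matrix.mul_assoc, Matrix.fromCols_mul_fromRows, constPoly_zero,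
    constPoly_neg, constPoly_one]
  simp

end System

/-! ### Constant unimodular completions of pencils -/

section Completion

/-- If `A - μ E` is onto for every `μ`, some section `s` of `A` makes `E s` nilpotent.
On the nonzero subspace `A (ker E)` choose `s` with values in `ker E`, so that `E s = 0` there; modulo
this subspace use induction. -/
theorem exists_nilpotent_section {V : Type*} [AddCommGroup V] [Module ℂ V] [FiniteDimensional ℂ V]
    (n : ℕ) : ∀ {W : Type*} [AddCommGroup W] [Module ℂ W] [FiniteDimensional ℂ W],
      Module.finrank ℂ W = n → ∀ A E : V →ₗ[ℂ] W,
      (∀ μ : ℂ, Function.Surjective (A - μ • E)) →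
      ∃ s : W →ₗ[ℂ] V, A ∘ₗ s = LinearMap.id ∧ IsNilpotent (E ∘ₗ s : Module.End ℂ W) := by
  induction n using Nat.strong_induction_on with
  | _ n ih =>
  intro W _ _ _ hn A E hsurj
  rcases subsingleton_or_nontrivial W with hW | hW
  · exact ⟨0, LinearMap.ext fun x => Subsingleton.elim _ _, ⟨1, LinearMap.ext fun x =>
      Subsingleton.elim _ _⟩⟩
  set W₁ := (LinearMap.ker E).map A
  have hne : W₁ ≠ ⊥ := by
    -- otherwise `A = N E`, and `A - μ E = (N - μ) E` is not onto for an eigenvalue `μ` of `N`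
    intro hbot
    have hker : LinearMap.ker E ≤ LinearMap.ker A := by
      intro x hx
      have : A x ∈ W₁ := Submodule.mem_map_of_mem hx
      rwa [hbot, Submodule.mem_bot] at this
    obtain ⟨N, hN⟩ := LinearMap.exists_extend
      (((LinearMap.ker E).liftQ A hker) ∘ₗ E.quotKerEquivRange.symm.toLinearMap)
    have hNE : ∀ x, N (E x) = A x := by
      intro x
      have := LinearMap.congr_fun hN ⟨E x, LinearMap.mem_range_self E x⟩
      simp only [LinearMap.comp_apply, Submodule.subtype_apply, LinearEquiv.coe_coe] at this
      rw [this]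
      have h2 : E.quotKerEquivRange.symm ⟨E x, LinearMap.mem_range_self E x⟩ =
          (LinearMap.ker E).mkQ x := by
        rw [LinearEquiv.symm_apply_eq]
        rfl
      rw [h2]
      simp
    obtain ⟨μ, hμ⟩ := Module.End.exists_eigenvalue N
    obtain ⟨w, hw⟩ := hμ.exists_hasEigenvector
    have hs : Function.Surjective (N - μ • LinearMap.id : W →ₗ[ℂ] W) := by
      intro y
      obtain ⟨x, hx⟩ := hsurj μ y
      exact ⟨E x, by simpa [hNE] using hx⟩
    have hi := LinearMap.injective_iff_surjective.2 hs
    refine hw.2 (hi ?_)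
    simp [hw.apply_eq_smul]
  have hlt : Module.finrank ℂ (W ⧸ W₁) < n := by
    have h1 := Submodule.finrank_quotient_add_finrank W₁
    have h2 : 0 < Module.finrank ℂ W₁ := by
      rw [Nat.pos_iff_ne_zero, Ne, Submodule.finrank_eq_zero]
      exact hne
    omega
  obtain ⟨s', hs', k, hk⟩ := ih _ hlt rfl (W₁.mkQ ∘ₗ A) (W₁.mkQ ∘ₗ E) fun μ y => by
    obtain ⟨w, rfl⟩ := W₁.mkQ_surjective y
    obtain ⟨x, rfl⟩ := hsurj μ w
    exact ⟨x, by simp⟩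
  obtain ⟨s₁, hs₁⟩ := LinearMap.exists_rightInverse_of_surjective (A.submoduleMap (LinearMap.ker E))
    (LinearMap.range_eq_top.2 (A.submoduleMap_surjective _))
  have hmem : ∀ w, (LinearMap.id - A ∘ₗ s' ∘ₗ W₁.mkQ : W →ₗ[ℂ] W) w ∈ W₁ := by
    intro w
    have := LinearMap.congr_fun hs' (W₁.mkQ w)
    simp only [LinearMap.comp_apply, LinearMap.id_apply] at this
    refine (Submodule.Quotient.mk_eq_zero W₁).1 ?_
    rw [← Submodule.mkQ_apply, LinearMap.sub_apply, map_sub, sub_eq_zero]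
    exact this.symm
  set c := LinearMap.codRestrict W₁ _ hmem
  set s := s' ∘ₗ W₁.mkQ + (LinearMap.ker E).subtype ∘ₗ s₁ ∘ₗ c with hs
  have hEs : ∀ w, E (s w) = E (s' (W₁.mkQ w)) := by
    intro w
    have : E (s₁ (c w) : V) = 0 := (s₁ (c w)).2
    simp [hs, this]
  have hpow : ∀ (j : ℕ) (w : W), W₁.mkQ (((E ∘ₗ s : Module.End ℂ W) ^ j) w) =
      (((W₁.mkQ ∘ₗ E) ∘ₗ s' : Module.End ℂ (W ⧸ W₁)) ^ j) (W₁.mkQ w) := by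
    intro j
    induction j with
    | zero => intro w; simp
    | succ j ihj =>
      intro w
      rw [pow_succ, pow_succ, Module.End.mul_apply, Module.End.mul_apply, ihj]
      simp only [LinearMap.comp_apply, hEs]
  refine ⟨s, LinearMap.ext fun w => ?_, k + 1, LinearMap.ext fun w => ?_⟩
  · have h1 : A (s₁ (c w) : V) = (c w : W) :=
      congrArg Subtype.val (LinearMap.congr_fun hs₁ (c w))
    have h2 : (c w : W) = w - A (s' (W₁.mkQ w)) := rfl
    simp only [hs, LinearMap.comp_apply, LinearMap.add_apply, map_add, Submodule.subtype_apply, h1,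
      h2, LinearMap.id_apply, add_sub_cancel]
  · have h1 := hpow k w
    rw [hk, LinearMap.zero_apply] at h1
    rw [pow_succ', Module.End.mul_apply, LinearMap.comp_apply, hEs, h1]
    simp

theorem Matrix.exists_left_inverse_of_injective {ι κ : Type*} [Fintype ι] [Fintype κ]
    [DecidableEq ι] [DecidableEq κ] {K : Type*} [Field K] {M : Matrix ι κ K}
    (h : ∀ v, M *ᵥ v = 0 → v = 0) : ∃ L : Matrix κ ι K, L * M = 1 := by
  obtain ⟨g, hg⟩ := LinearMap.exists_leftInverse_of_injective (Matrix.toLin' M)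
    (LinearMap.ker_eq_bot'.2 h)
  refine ⟨LinearMap.toMatrix' g, ?_⟩
  rw [← LinearMap.toMatrix'_id, ← hg, LinearMap.toMatrix'_comp, LinearMap.toMatrix'_toLin']

variable {ι κ : Type*} [Fintype ι] [Fintype κ] [DecidableEq ι] [DecidableEq κ]

theorem isUnit_pencil_one {N : Matrix ι ι ℂ} (hN : IsNilpotent N) : IsUnit (pencil 1 N) := by
  have h1 : IsNilpotent (constPoly N) := hN.map (Polynomial.C : ℂ →+* ℂ[X]).mapMatrix
  rw [pencil, constPoly_one]
  exact (h1.smul _).isUnit_one_sub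

/-- With a section `s` of `A` such that `E s` is nilpotent and a matrix `k` whose columns are a basis
of `ker A`, the matrix `Z` with `Z s = 0` and `Z k = 1` is a completion: in the basis `[s, k]` the
completed pencil is `[1 - λ E s, -λ E k; 0, 1]`. -/
theorem exists_unimodular_completion {k : ℕ} {A E : Matrix ι κ ℂ}
    (h : ∀ μ : ℂ, FullRowRank (A - μ • E)) (hcard : Fintype.card κ = Fintype.card ι + k) :
    ∃ Z : Matrix (Fin k) κ ℂ, IsUnimodular (fromRows (pencil A E) (constPoly Z)) := by
  obtain ⟨s, hs, hnil⟩ := exists_nilpotent_section _ rfl (Matrix.toLin' A) (Matrix.toLin' E)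
    fun μ => by
      intro w
      obtain ⟨v, hv⟩ := (fullRowRank_iff _).1 (h μ) w
      exact ⟨v, by simpa [Matrix.sub_mulVec, Matrix.smul_mulVec] using hv⟩
  set S := LinearMap.toMatrix' s
  have hAS : A * S = 1 := by
    have := congrArg LinearMap.toMatrix' hs
    rwa [LinearMap.toMatrix'_comp, LinearMap.toMatrix'_toLin', LinearMap.toMatrix'_id] at this
  have hES : IsNilpotent (E * S) := by
    have := hnil.map (LinearMap.toMatrixAlgEquiv' : Module.End ℂ (ι → ℂ) ≃ₐ[ℂ] Matrix ι ι ℂ)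
    have h2 : LinearMap.toMatrix' (Matrix.toLin' E ∘ₗ s) = E * S := by
      rw [LinearMap.toMatrix'_comp, LinearMap.toMatrix'_toLin']
    rw [← h2]
    exact this
  have hker : Module.finrank ℂ (LinearMap.ker A.mulVecLin) = k := by
    have h1 := LinearMap.finrank_range_add_finrank_ker A.mulVecLin
    have h2 : A.rank = Fintype.card ι := by simpa [FullRowRank] using h 0
    rw [Module.finrank_fintype_fun_eq_card] at h1
    rw [Matrix.rank] at h2
    omega
  set b := Module.finBasisOfFinrankEq ℂ _ hker
  set T : Matrix κ (Fin k) ℂ := Matrix.of fun i j => (b j : κ → ℂ) i with hT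
  have hTv : ∀ v, T *ᵥ v = ((∑ j, v j • b j : LinearMap.ker A.mulVecLin) : κ → ℂ) := by
    intro v
    ext i
    simp [hT, Matrix.mulVec, dotProduct, mul_comm]
  have hAT : A * T = 0 := by
    ext i j
    exact congrFun (LinearMap.mem_ker.1 (b j).2) i
  have hinj : ∀ v, fromCols S T *ᵥ v = 0 → v = 0 := by
    intro v hv
    rw [Matrix.fromCols_mulVec] at hv
    have h1 : v ∘ Sum.inl = 0 := by
      have := congrArg (A *ᵥ ·) hv
      simpa [Matrix.mulVec_add, Matrix.mulVec_mulVec, hAS, hAT] using this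
    have h2 : v ∘ Sum.inr = 0 := by
      rw [h1, Matrix.mulVec_zero, zero_add, hTv] at hv
      have := Fintype.linearIndependent_iff.1 b.linearIndependent _ (Subtype.ext hv)
      exact funext this
    ext (i | i)
    · exact congrFun h1 i
    · exact congrFun h2 i
  obtain ⟨Y, hY⟩ := Matrix.exists_left_inverse_of_injective hinj
  rw [← Matrix.fromRows_toRows Y, Matrix.fromRows_mul_fromCols, ← Matrix.fromBlocks_one,
    Matrix.fromBlocks_inj] at hY
  obtain ⟨-, -, hZS, hZT⟩ := hY
  obtain ⟨G, hG⟩ := (isUnit_pencil_one hES).exists_right_inv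
  let R : Matrix κ (ι ⊕ Fin k) ℂ[X] := constPoly (fromCols S T) *
    (fromBlocks G (-(G * (pencil A E * constPoly T))) 0 1 : Matrix (ι ⊕ Fin k) (ι ⊕ Fin k) ℂ[X])
  have hright : fromRows (pencil A E) (constPoly Y.toRows₂) * R = 1 := by
    rw [← Matrix.mul_assoc, constPoly_fromCols, Matrix.fromRows_mul_fromCols, pencil_mul A E S, hAS,
      ← constPoly_mul, ← constPoly_mul, hZS, hZT, constPoly_one, constPoly_zero,
      Matrix.fromBlocks_multiply]
    simp [← Matrix.mul_assoc, hG]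
  exact ⟨Y.toRows₂, R, hright,
    (Matrix.mul_eq_one_comm_of_card_eq _ _ _ (by simp [hcard])).1 hright⟩

end Completion

/-! ### Unitary matrices adapted to a flag of subspaces -/

section Flag

variable {ι : Type*} [Fintype ι] [DecidableEq ι]

theorem exists_unitary_split (U : Submodule ℂ (ι → ℂ)) :
    ∃ (a b : ℕ) (Z : Matrix ι (Fin a ⊕ Fin b) ℂ), Zᴴ * Z = 1 ∧ Z * Zᴴ = 1 ∧
      ∀ w, w ∈ U ↔ (Zᴴ *ᵥ w) ∘ Sum.inr = 0 := by
  set U' : Submodule ℂ (EuclideanSpace ℂ ι) :=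
    U.comap (WithLp.linearEquiv 2 ℂ (ι → ℂ)).toLinearMap
  set u := stdOrthonormalBasis ℂ U'
  set c := stdOrthonormalBasis ℂ U'ᗮ
  set f : Fin (Module.finrank ℂ U') ⊕ Fin (Module.finrank ℂ U'ᗮ) → EuclideanSpace ℂ ι :=
    Sum.elim (fun j => (u j : EuclideanSpace ℂ ι)) (fun j => (c j : EuclideanSpace ℂ ι)) with hf
  have hinner : ∀ x w : EuclideanSpace ℂ ι, inner ℂ x w = ∑ i, star (x i) * w i := by
    intro x w
    simp [PiLp.inner_apply, mul_comm]
  have hZZ : (Matrix.of fun i j => f j i)ᴴ * (Matrix.of fun i j => f j i) = 1 := by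
    have huc : ∀ i j, inner ℂ (u i : EuclideanSpace ℂ ι) (c j : EuclideanSpace ℂ ι) = 0 :=
      fun i j => (c j).2 _ (u i).2
    ext i j
    have : ((Matrix.of fun i j => f j i)ᴴ * (Matrix.of fun i j => f j i)) i j =
        inner ℂ (f i) (f j) := by
      rw [hinner]
      rfl
    rw [this]
    rcases i with i | i <;> rcases j with j | j
    · simpa [hf, Matrix.one_apply] using orthonormal_iff_ite.1 u.orthonormal i j
    · simp [hf, huc]
    · simp [hf, inner_eq_zero_symm.1 (huc j i)]
    · simpa [hf, Matrix.one_apply] using orthonormal_iff_ite.1 c.orthonormal i j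
  refine ⟨_, _, Matrix.of fun i j => f j i, hZZ,
    (Matrix.mul_eq_one_comm_of_card_eq _ _ _ ?_).1 hZZ, fun w => ?_⟩
  · rw [Fintype.card_sum, Fintype.card_fin, Fintype.card_fin, Submodule.finrank_add_finrank_orthogonal,
      finrank_euclideanSpace]
  · have h1 : w ∈ U ↔ WithLp.toLp 2 w ∈ U'ᗮᗮ := by
      rw [Submodule.orthogonal_orthogonal]
      rfl
    have h2 : ∀ j, ((Matrix.of fun i j => f j i)ᴴ *ᵥ w) (Sum.inr j) =
        inner ℂ (c j : EuclideanSpace ℂ ι) (WithLp.toLp 2 w) := by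
      intro j
      rw [hinner]
      rfl
    rw [h1, funext_iff]
    simp only [Function.comp_apply, h2, Pi.zero_apply]
    constructor
    · exact fun h j => h _ (c j).2
    · intro h x hx
      have hx' : x = ∑ j, c.repr ⟨x, hx⟩ j • (c j : EuclideanSpace ℂ ι) := by
        have := congrArg Subtype.val (c.sum_repr ⟨x, hx⟩)
        simpa using this.symm
      rw [hx', sum_inner]
      exact Finset.sum_eq_zero fun j _ => by rw [inner_smul_left, h, mul_zero]

/-- Splitting off the first step of a flag: `φ` sends the subspaces above `U` to the remaining
coordinates, where any unitary matrix may be used to continue. -/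
theorem exists_unitary_cons (U : Submodule ℂ (ι → ℂ)) :
    ∃ (a e : ℕ) (φ : Submodule ℂ (ι → ℂ) → Submodule ℂ (Fin e → ℂ)), Monotone φ ∧
      ∀ {τ : Type} [Fintype τ] [DecidableEq τ] (Y : Matrix (Fin e) τ ℂ),
        Yᴴ * Y = 1 → Y * Yᴴ = 1 → ∃ Z : Matrix ι (Fin a ⊕ τ) ℂ, Zᴴ * Z = 1 ∧ Z * Zᴴ = 1 ∧
          (∀ w, w ∈ U ↔ (Zᴴ *ᵥ w) ∘ Sum.inr = 0) ∧
          ∀ w, ∃ x, (Zᴴ *ᵥ w) ∘ Sum.inr = Yᴴ *ᵥ x ∧ ∀ U₂, U ≤ U₂ → (w ∈ U₂ ↔ x ∈ φ U₂) := by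
  obtain ⟨a, e, Z, hZ, hZ', hU⟩ := exists_unitary_split U
  refine ⟨a, e, fun U₂ => U₂.comap (Z.submatrix id Sum.inr).mulVecLin,
    fun _ _ h => Submodule.comap_mono h, fun {τ} _ _ Y hY hY' => ?_⟩
  let D : Matrix (Fin a ⊕ Fin e) (Fin a ⊕ τ) ℂ := fromBlocks 1 0 0 Y
  have hD : Dᴴ * D = 1 := by
    simp [D, Matrix.fromBlocks_conjTranspose, Matrix.fromBlocks_multiply, hY]
  have hD' : D * Dᴴ = 1 := by
    simp [D, Matrix.fromBlocks_conjTranspose, Matrix.fromBlocks_multiply, hY']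
  have hcomp : ∀ w, ((Z * D)ᴴ *ᵥ w) ∘ Sum.inr = Yᴴ *ᵥ ((Zᴴ *ᵥ w) ∘ Sum.inr) := by
    intro w
    rw [Matrix.conjTranspose_mul, ← Matrix.mulVec_mulVec, Matrix.fromBlocks_conjTranspose,
      Matrix.fromBlocks_mulVec]
    ext i
    simp
  have hYinj : ∀ x, Yᴴ *ᵥ x = 0 ↔ x = 0 := by
    refine fun x => ⟨fun h => ?_, fun h => by rw [h, Matrix.mulVec_zero]⟩
    rw [← Matrix.one_mulVec x, ← hY', ← Matrix.mulVec_mulVec, h, Matrix.mulVec_zero]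
  refine ⟨Z * D, ?_, ?_, fun w => ?_, fun w => ⟨(Zᴴ *ᵥ w) ∘ Sum.inr, hcomp w, fun U₂ hle => ?_⟩⟩
  · rw [Matrix.conjTranspose_mul, Matrix.mul_assoc, ← Matrix.mul_assoc Zᴴ, hZ, Matrix.one_mul, hD]
  · rw [Matrix.conjTranspose_mul, Matrix.mul_assoc, ← Matrix.mul_assoc D, hD', Matrix.one_mul, hZ']
  · rw [hU, hcomp, hYinj]
  · have h1 : w = Z *ᵥ Sum.elim ((Zᴴ *ᵥ w) ∘ Sum.inl) 0 +
        Z.submatrix id Sum.inr *ᵥ ((Zᴴ *ᵥ w) ∘ Sum.inr) := by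
      conv_lhs => rw [← Matrix.one_mulVec w, ← hZ', ← Matrix.mulVec_mulVec]
      ext i
      simp [Matrix.mulVec, dotProduct, Fintype.sum_sum_type]
    have h2 : Z *ᵥ Sum.elim ((Zᴴ *ᵥ w) ∘ Sum.inl) 0 ∈ U₂ := by
      refine hle ((hU _).2 ?_)
      rw [Matrix.mulVec_mulVec, hZ, Matrix.one_mulVec]
      rfl
    conv_lhs => rw [h1]
    rw [U₂.add_mem_iff_right h2]
    rfl

theorem exists_unitary_flag_two {U₁ U₂ : Submodule ℂ (ι → ℂ)} (h₁ : U₁ ≤ U₂) :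
    ∃ (a b c : ℕ) (Z : Matrix ι (Fin a ⊕ Fin b ⊕ Fin c) ℂ), Zᴴ * Z = 1 ∧ Z * Zᴴ = 1 ∧
      (∀ w, w ∈ U₁ ↔ (Zᴴ *ᵥ w) ∘ Sum.inr = 0) ∧
      ∀ w, w ∈ U₂ ↔ (Zᴴ *ᵥ w) ∘ Sum.inr ∘ Sum.inr = 0 := by
  obtain ⟨a, e, φ, -, hφ⟩ := exists_unitary_cons U₁
  obtain ⟨b, c, Y, hY, hY', hYU⟩ := exists_unitary_split (φ U₂)
  obtain ⟨Z, hZ, hZ', hZU, hZx⟩ := hφ Y hY hY'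
  refine ⟨a, b, c, Z, hZ, hZ', hZU, fun w => ?_⟩
  obtain ⟨x, hx, hxU⟩ := hZx w
  rw [hxU _ h₁, hYU, ← Function.comp_assoc, hx]

theorem exists_unitary_flag_three {U₁ U₂ U₃ : Submodule ℂ (ι → ℂ)} (h₁ : U₁ ≤ U₂) (h₂ : U₂ ≤ U₃) :
    ∃ (a b c e : ℕ) (Z : Matrix ι (Fin a ⊕ Fin b ⊕ Fin c ⊕ Fin e) ℂ), Zᴴ * Z = 1 ∧ Z * Zᴴ = 1 ∧
      (∀ w, w ∈ U₁ ↔ (Zᴴ *ᵥ w) ∘ Sum.inr = 0) ∧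
      (∀ w, w ∈ U₂ ↔ (Zᴴ *ᵥ w) ∘ Sum.inr ∘ Sum.inr = 0) ∧
      ∀ w, w ∈ U₃ ↔ (Zᴴ *ᵥ w) ∘ Sum.inr ∘ Sum.inr ∘ Sum.inr = 0 := by
  obtain ⟨a, k, φ, hmono, hφ⟩ := exists_unitary_cons U₁
  obtain ⟨b, c, e, Y, hY, hY', hYU, hYU'⟩ := exists_unitary_flag_two (hmono h₂)
  obtain ⟨Z, hZ, hZ', hZU, hZx⟩ := hφ Y hY hY'
  refine ⟨a, b, c, e, Z, hZ, hZ', hZU, fun w => ?_, fun w => ?_⟩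
  · obtain ⟨x, hx, hxU⟩ := hZx w
    rw [hxU _ h₁, hYU, ← Function.comp_assoc, hx]
  · obtain ⟨x, hx, hxU⟩ := hZx w
    rw [hxU _ (h₁.trans h₂), hYU', ← hx]
    rfl

end Flag

/-! ### Deflating subspaces of a pencil -/

/-- The subspaces behind the staircase form of the pencil `A - λ E` on `K`. `X₂` is maximal with
`A X₂ ≤ E X₂` inside `K`; `X₁` is minimal with `A X₁ ≤ E X₁` among the subspaces of `X₂` that contain
`ker E ⊓ X₂`. -/
theorem exists_deflating_subspaces {V W : Type*} [AddCommGroup V] [Module ℂ V]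
    [FiniteDimensional ℂ V] [AddCommGroup W] [Module ℂ W] (A E : V →ₗ[ℂ] W) (K : Submodule ℂ V) :
    ∃ X₁ X₂ : Submodule ℂ V, X₁ ≤ X₂ ∧ X₂ ≤ K ∧ X₁.map A ≤ X₁.map E ∧ X₂.map A ≤ X₂.map E ∧
      (∀ x ∈ K, ∀ μ : ℂ, A x - μ • E x ∈ X₂.map E → x ∈ X₂) ∧
      (∀ x ∈ X₂, E x ∈ X₁.map E → x ∈ X₁) ∧
      ∀ μ : ℂ, ∀ x ∈ X₁, ∃ y ∈ X₁, A y - μ • E y = E x := by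
  obtain ⟨X₂, ⟨hK, hAE⟩, hmax⟩ := WellFounded.has_min
    (r := ((· > ·) : Submodule ℂ V → Submodule ℂ V → Prop)) wellFounded_gt
    {U | U ≤ K ∧ U.map A ≤ U.map E} ⟨⊥, bot_le, by simp⟩
  obtain ⟨X₁, ⟨hX, hkX, hAE₁⟩, hmin⟩ := WellFounded.has_min
    (r := ((· < ·) : Submodule ℂ V → Submodule ℂ V → Prop)) wellFounded_lt
    {U | U ≤ X₂ ∧ LinearMap.ker E ⊓ X₂ ≤ U ∧ U.map A ≤ U.map E} ⟨X₂, le_rfl, inf_le_right, hAE⟩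
  have hclosed : ∀ x ∈ X₂, E x ∈ X₁.map E → x ∈ X₁ := by
    rintro x hx ⟨y, hy, hyx⟩
    have : x - y ∈ X₁ := hkX ⟨by simp [hyx], X₂.sub_mem hx (hX hy)⟩
    simpa using X₁.add_mem this hy
  refine ⟨X₁, X₂, hX, hK, hAE₁, hAE, fun x hx μ h => ?_, hclosed, fun μ x hx => ?_⟩
  · by_contra hx2
    refine hmax (X₂ ⊔ Submodule.span ℂ {x})
      ⟨sup_le hK ((Submodule.span_singleton_le_iff_mem _ _).2 hx), ?_⟩ ?_
    · rw [Submodule.map_sup, Submodule.map_sup]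
      refine sup_le (hAE.trans le_sup_left) ?_
      rw [Submodule.map_span, Set.image_singleton, Submodule.span_singleton_le_iff_mem,
        Submodule.map_span, Set.image_singleton]
      have h1 : A x = (A x - μ • E x) + μ • E x := by abel
      rw [h1]
      exact Submodule.add_mem _ (Submodule.mem_sup_left h)
        (Submodule.mem_sup_right (Submodule.smul_mem _ _ (Submodule.mem_span_singleton_self _)))
    · refine lt_of_le_of_ne le_sup_left fun he => hx2 ?_
      rw [he]
      exact Submodule.mem_sup_right (Submodule.mem_span_singleton_self _)
  · -- the subspace of all `z ∈ X₂` with `E z ∈ (A - μ E) X₁` competes with the minimal `X₁`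
    set T := X₂ ⊓ (X₁.map (A - μ • E)).comap E
    have hTX : T ≤ X₁ := by
      rintro z ⟨hz, y, hy, hyz⟩
      refine hclosed z hz ?_
      rw [← hyz, LinearMap.sub_apply, LinearMap.smul_apply]
      exact Submodule.sub_mem _ (hAE₁ ⟨y, hy, rfl⟩) (Submodule.smul_mem _ _ ⟨y, hy, rfl⟩)
    have hTmem : T ∈ {U | U ≤ X₂ ∧ LinearMap.ker E ⊓ X₂ ≤ U ∧ U.map A ≤ U.map E} := by
      refine ⟨inf_le_left, fun z hz => ⟨hz.2, ?_⟩, ?_⟩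
      · rw [SetLike.mem_coe, Submodule.mem_comap, LinearMap.mem_ker.1 hz.1]
        exact Submodule.zero_mem _
      · rintro _ ⟨z, hz, rfl⟩
        obtain ⟨y, hy, hyz⟩ := hAE ⟨z, hz.1, rfl⟩
        have h1 : y - μ • z ∈ T := by
          refine ⟨X₂.sub_mem hy (X₂.smul_mem _ hz.1), z, hTX hz, ?_⟩
          simp [hyz]
        refine ⟨y, ?_, hyz⟩
        simpa using T.add_mem h1 (T.smul_mem μ hz)
    have hTeq : T = X₁ := by
      by_contra hne
      exact hmin T hTmem (lt_of_le_of_ne hTX hne)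
    obtain ⟨-, y, hy, hyx⟩ := hTeq.ge hx
    exact ⟨y, hy, by simpa using hyx⟩

/-! ### Unitary coordinates for the deflating subspaces -/

/-- The staircase form in terms of the transformed pencil `MA - λ ME`: the conditions say which
coordinates vanish on the deflating subspaces and on their images. -/
theorem exists_adapted_unitary {ι κ ρ : Type*} [Fintype ι] [Fintype κ] [Fintype ρ] [DecidableEq ι]
    [DecidableEq κ] (A E : Matrix ι κ ℂ) (C : Matrix ρ κ ℂ) :
    ∃ (a₁ a₂ a₃ b₁ b₃ b₄ : ℕ) (Q : Matrix ι (Fin a₁ ⊕ Fin a₂ ⊕ Fin a₃) ℂ)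
      (Z : Matrix κ (Fin b₁ ⊕ Fin a₂ ⊕ Fin b₃ ⊕ Fin b₄) ℂ),
      (Qᴴ * Q = 1 ∧ Q * Qᴴ = 1) ∧ (Zᴴ * Z = 1 ∧ Z * Zᴴ = 1) ∧
      (∀ x, x ∘ Sum.inr = 0 → ((Qᴴ * A * Z) *ᵥ x) ∘ Sum.inr = 0) ∧
      (∀ x, x ∘ Sum.inr = 0 → ((Qᴴ * E * Z) *ᵥ x) ∘ Sum.inr = 0) ∧
      (∀ x, x ∘ Sum.inr ∘ Sum.inr = 0 → ((Qᴴ * A * Z) *ᵥ x) ∘ Sum.inr ∘ Sum.inr = 0) ∧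
      (∀ x, x ∘ Sum.inr ∘ Sum.inr = 0 → ((Qᴴ * E * Z) *ᵥ x) ∘ Sum.inr ∘ Sum.inr = 0) ∧
      (∀ w, w ∘ Sum.inr = 0 → ∃ x, x ∘ Sum.inr = 0 ∧ (Qᴴ * E * Z) *ᵥ x = w) ∧
      (∀ (μ : ℂ) w, w ∘ Sum.inr = 0 → ∃ x, x ∘ Sum.inr = 0 ∧
        (Qᴴ * A * Z - μ • (Qᴴ * E * Z)) *ᵥ x = w) ∧
      (∀ x, x ∘ Sum.inr ∘ Sum.inr = 0 → ((Qᴴ * E * Z) *ᵥ x) ∘ Sum.inr = 0 → x ∘ Sum.inr = 0) ∧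
      (∀ (μ : ℂ) x, x ∘ Sum.inr ∘ Sum.inr ∘ Sum.inr = 0 →
        ((Qᴴ * A * Z - μ • (Qᴴ * E * Z)) *ᵥ x) ∘ Sum.inr ∘ Sum.inr = 0 →
          x ∘ Sum.inr ∘ Sum.inr = 0) ∧
      (∀ x, (C * Z) *ᵥ x = 0 ↔ x ∘ Sum.inr ∘ Sum.inr ∘ Sum.inr = 0) := by
  obtain ⟨X₁, X₂, h12, h2K, hA₁, hA₂, hmax, hcl, hsurj⟩ :=
    exists_deflating_subspaces A.mulVecLin E.mulVecLin (LinearMap.ker C.mulVecLin)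
  obtain ⟨b₁, b₂, b₃, b₄, Z, hZ, hZ', hX₁, hX₂, hK⟩ := exists_unitary_flag_three h12 h2K
  obtain ⟨a₁, a₂, a₃, Q, hQ, hQ', hY₁, hY₂⟩ :=
    exists_unitary_flag_two (Submodule.map_mono (f := E.mulVecLin) h12)
  have hZx : ∀ x, Zᴴ *ᵥ (Z *ᵥ x) = x := fun x => by
    rw [Matrix.mulVec_mulVec, hZ, Matrix.one_mulVec]
  have hQw : ∀ w, Qᴴ *ᵥ (Q *ᵥ w) = w := fun x => by
    rw [Matrix.mulVec_mulVec, hQ, Matrix.one_mulVec]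
  have hZw : ∀ w, Z *ᵥ (Zᴴ *ᵥ w) = w := fun x => by
    rw [Matrix.mulVec_mulVec, hZ', Matrix.one_mulVec]
  have hX₁' : ∀ x, Z *ᵥ x ∈ X₁ ↔ x ∘ Sum.inr = 0 := fun x => by rw [hX₁, hZx]
  have hX₂' : ∀ x, Z *ᵥ x ∈ X₂ ↔ x ∘ Sum.inr ∘ Sum.inr = 0 := fun x => by rw [hX₂, hZx]
  have hK' : ∀ x, C *ᵥ (Z *ᵥ x) = 0 ↔ x ∘ Sum.inr ∘ Sum.inr ∘ Sum.inr = 0 := fun x => by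
    have := hK (Z *ᵥ x)
    rw [hZx] at this
    exact this
  have hM : ∀ (M : Matrix ι κ ℂ) x, (Qᴴ * M * Z) *ᵥ x = Qᴴ *ᵥ (M *ᵥ (Z *ᵥ x)) := fun M x => by
    rw [Matrix.mulVec_mulVec, Matrix.mulVec_mulVec, Matrix.mul_assoc]
  have hMμ : ∀ (μ : ℂ) x, (Qᴴ * A * Z - μ • (Qᴴ * E * Z)) *ᵥ x =
      Qᴴ *ᵥ (A *ᵥ (Z *ᵥ x) - μ • E *ᵥ (Z *ᵥ x)) := fun μ x => by
    rw [Matrix.sub_mulVec, Matrix.smul_mulVec, hM, hM, Matrix.mulVec_sub, Matrix.mulVec_smul]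
  have hE22 : ∀ x, x ∘ Sum.inr ∘ Sum.inr = 0 → ((Qᴴ * E * Z) *ᵥ x) ∘ Sum.inr = 0 →
      x ∘ Sum.inr = 0 := by
    intro x hx h
    rw [hM, ← hY₁] at h
    exact (hX₁' x).1 (hcl _ ((hX₂' x).2 hx) h)
  have hE22' : ∀ w, w ∘ Sum.inr ∘ Sum.inr = 0 → ∃ x, x ∘ Sum.inr ∘ Sum.inr = 0 ∧
      (Qᴴ * E * Z) *ᵥ x = w := by
    intro w hw
    obtain ⟨y, hy, hyw⟩ := (hY₂ (Q *ᵥ w)).2 (by rw [hQw, hw])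
    refine ⟨Zᴴ *ᵥ y, (hX₂ _).1 hy, ?_⟩
    rw [hM, hZw]
    exact (congrArg (Qᴴ *ᵥ ·) hyw).trans (hQw w)
  have hA1 : ∀ x, x ∘ Sum.inr = 0 → ((Qᴴ * A * Z) *ᵥ x) ∘ Sum.inr = 0 := by
    intro x hx
    rw [hM, ← hY₁]
    exact hA₁ ⟨_, (hX₁' x).2 hx, rfl⟩
  have hE1 : ∀ x, x ∘ Sum.inr = 0 → ((Qᴴ * E * Z) *ᵥ x) ∘ Sum.inr = 0 := by
    intro x hx
    rw [hM, ← hY₁]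
    exact ⟨_, (hX₁' x).2 hx, rfl⟩
  have hA2 : ∀ x, x ∘ Sum.inr ∘ Sum.inr = 0 →
      ((Qᴴ * A * Z) *ᵥ x) ∘ Sum.inr ∘ Sum.inr = 0 := by
    intro x hx
    rw [hM, ← hY₂]
    exact hA₂ ⟨_, (hX₂' x).2 hx, rfl⟩
  have hE2 : ∀ x, x ∘ Sum.inr ∘ Sum.inr = 0 →
      ((Qᴴ * E * Z) *ᵥ x) ∘ Sum.inr ∘ Sum.inr = 0 := by
    intro x hx
    rw [hM, ← hY₂]
    exact ⟨_, (hX₂' x).2 hx, rfl⟩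
  have hEs : ∀ w, w ∘ Sum.inr = 0 → ∃ x, x ∘ Sum.inr = 0 ∧ (Qᴴ * E * Z) *ᵥ x = w := by
    intro w hw
    obtain ⟨y, hy, hyw⟩ := (hY₁ (Q *ᵥ w)).2 (by rw [hQw, hw])
    refine ⟨Zᴴ *ᵥ y, (hX₁ _).1 hy, ?_⟩
    rw [hM, hZw]
    exact (congrArg (Qᴴ *ᵥ ·) hyw).trans (hQw w)
  have hμs : ∀ (μ : ℂ) w, w ∘ Sum.inr = 0 → ∃ x, x ∘ Sum.inr = 0 ∧
      (Qᴴ * A * Z - μ • (Qᴴ * E * Z)) *ᵥ x = w := by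
    intro μ w hw
    obtain ⟨y, hy, hyw⟩ := (hY₁ (Q *ᵥ w)).2 (by rw [hQw, hw])
    obtain ⟨z, hz, hzy⟩ := hsurj μ y hy
    refine ⟨Zᴴ *ᵥ z, (hX₁ _).1 hz, ?_⟩
    rw [hMμ, hZw]
    exact (congrArg (Qᴴ *ᵥ ·) (hzy.trans hyw)).trans (hQw w)
  have hl : ∀ (μ : ℂ) x, x ∘ Sum.inr ∘ Sum.inr ∘ Sum.inr = 0 →
      ((Qᴴ * A * Z - μ • (Qᴴ * E * Z)) *ᵥ x) ∘ Sum.inr ∘ Sum.inr = 0 →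
        x ∘ Sum.inr ∘ Sum.inr = 0 := by
    intro μ x hx h
    rw [hMμ, ← hY₂] at h
    exact (hX₂' x).1 (hmax _ ((hK' x).2 hx) μ h)
  -- `E` induces a bijection on the second diagonal block, which therefore is square
  have hsq : a₂ = b₂ := by
    let f : (Fin b₂ → ℂ) →ₗ[ℂ] (Fin a₂ → ℂ) :=
      ((Qᴴ * E * Z).submatrix (Sum.inr ∘ Sum.inl) (Sum.inr ∘ Sum.inl)).mulVecLin
    have hf : ∀ u, f u =
        ((Qᴴ * E * Z) *ᵥ Sum.elim 0 (Sum.elim u 0)) ∘ Sum.inr ∘ Sum.inl := by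
      intro u
      ext i
      simp [f, Matrix.mulVec, dotProduct, Fintype.sum_sum_type]
    have hinj : Function.Injective f := by
      rw [← LinearMap.ker_eq_bot, LinearMap.ker_eq_bot']
      intro u hu
      rw [hf] at hu
      have h0 : (Sum.elim (0 : Fin b₁ → ℂ) (Sum.elim u (0 : Fin b₃ ⊕ Fin b₄ → ℂ))) ∘
          Sum.inr ∘ Sum.inr = 0 := rfl
      have h1 := hE22 _ h0 (by
        ext (i | i)
        · exact congrFun hu i
        · exact congrFun (hE2 _ h0) i)
      exact funext fun i => congrFun h1 (Sum.inl i)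
    have hsur : Function.Surjective f := by
      intro w
      obtain ⟨x, hx, hxw⟩ := hE22' (Sum.elim 0 (Sum.elim w 0)) rfl
      refine ⟨x ∘ Sum.inr ∘ Sum.inl, ?_⟩
      have hdec : x = Sum.elim (x ∘ Sum.inl) (0 : Fin b₂ ⊕ Fin b₃ ⊕ Fin b₄ → ℂ) +
          Sum.elim (0 : Fin b₁ → ℂ) (Sum.elim (x ∘ Sum.inr ∘ Sum.inl)
            (0 : Fin b₃ ⊕ Fin b₄ → ℂ)) := by
        ext (i | i | i)
        · simp
        · simp
        · simpa using congrFun hx i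
      have h1 : ((Qᴴ * E * Z) *ᵥ Sum.elim (x ∘ Sum.inl) 0) ∘ Sum.inr = 0 := hE1 _ rfl
      rw [hf]
      ext i
      have h2 := congrFun hxw (Sum.inr (Sum.inl i))
      rw [hdec, Matrix.mulVec_add, Pi.add_apply] at h2
      have h3 := congrFun h1 (Sum.inl i)
      simp only [Function.comp_apply, Pi.zero_apply] at h3
      rw [h3, zero_add] at h2
      exact h2
    have := (LinearEquiv.ofBijective f ⟨hinj, hsur⟩).finrank_eq
    simpa using this.symm
  subst hsq
  exact ⟨a₁, a₂, a₃, b₁, b₃, b₄, Q, Z, ⟨hQ, hQ'⟩, ⟨hZ, hZ'⟩, hA1, hE1, hA2, hE2, hEs, hμs, hE22, hl,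
    fun x => by rw [← Matrix.mulVec_mulVec, hK']⟩

section Transform

variable {m n d : ℕ}

theorem leftQ_mul_subPencil_mul (S : Staircase m n d) (P : Matrix (Fin m) (Fin n) ℂ[X]) :
    constPoly (S.leftQ m) * subPencil d P * constPoly S.Z =
      fromRows (pencil (S.Qᴴ * topA n d * S.Z) (S.Qᴴ * topE n d * S.Z))
        (constPoly (coeffRow d P * S.Z)) := by
  rw [Staircase.leftQ, subPencil, constPoly_fromBlocks, Matrix.fromBlocks_mul_fromRows,
    Matrix.fromRows_mul, constPoly_zero, constPoly_zero, constPoly_one, mul_pencil,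
    Matrix.zero_mul, Matrix.zero_mul, add_zero, zero_add, Matrix.one_mul, pencil_mul, constPoly_mul]

theorem Staircase.form_iff (S : Staircase m n d) (P : Matrix (Fin m) (Fin n) ℂ[X]) :
    constPoly (S.leftQ m) * subPencil d P * constPoly S.Z = fromRows S.top (constPoly S.bottom) ↔
      pencil (S.Qᴴ * topA n d * S.Z) (S.Qᴴ * topE n d * S.Z) = S.top ∧
        coeffRow d P * S.Z = S.bottom := by
  rw [leftQ_mul_subPencil_mul, Matrix.fromRows_ext_iff, constPoly_injective.eq_iff]

end Transform

/-! ### The number of right Kronecker blocks -/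

section Count

variable {m n d r : ℕ}

theorem Staircase.top_map_mulVec {R : Type*} [CommRing R] (S : Staircase m n d) (f : ℂ[X] →+* R)
    (y : Fin S.b₁ ⊕ Fin S.a₂ ⊕ Fin S.b₃ ⊕ Fin S.b₄ → R) :
    S.top.map f *ᵥ y =
      Sum.elim ((pencil S.A₁₁ S.E₁₁).map f *ᵥ (y ∘ Sum.inl) +
          ((pencil S.A₁₂ S.E₁₂).map f *ᵥ (y ∘ Sum.inr ∘ Sum.inl) +
            ((pencil S.A₁₃ S.E₁₃).map f *ᵥ (y ∘ Sum.inr ∘ Sum.inr ∘ Sum.inl) +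
              (pencil S.A₁₄ S.E₁₄).map f *ᵥ (y ∘ Sum.inr ∘ Sum.inr ∘ Sum.inr))))
        (Sum.elim ((pencil S.A₂₂ S.E₂₂).map f *ᵥ (y ∘ Sum.inr ∘ Sum.inl) +
            ((pencil S.A₂₃ S.E₂₃).map f *ᵥ (y ∘ Sum.inr ∘ Sum.inr ∘ Sum.inl) +
              (pencil S.A₂₄ S.E₂₄).map f *ᵥ (y ∘ Sum.inr ∘ Sum.inr ∘ Sum.inr)))
          ((pencil S.A₃₃ S.E₃₃).map f *ᵥ (y ∘ Sum.inr ∘ Sum.inr ∘ Sum.inl) +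
            (pencil S.A₃₄ S.E₃₄).map f *ᵥ (y ∘ Sum.inr ∘ Sum.inr ∘ Sum.inr))) := by
  ext (i | i | i) <;>
  simp [Staircase.top, Matrix.mulVec, dotProduct, Fintype.sum_sum_type]

theorem Staircase.bottom_map_mulVec {R : Type*} [CommRing R] (S : Staircase m n d) (f : ℂ[X] →+* R)
    (y : Fin S.b₁ ⊕ Fin S.a₂ ⊕ Fin S.b₃ ⊕ Fin S.b₄ → R) :
    (constPoly S.bottom).map f *ᵥ y =
      (constPoly S.C₄).map f *ᵥ (y ∘ Sum.inr ∘ Sum.inr ∘ Sum.inr) := by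
  ext i
  simp [Staircase.bottom, constPoly, Matrix.mulVec, dotProduct, Fintype.sum_sum_type]

theorem det_pencil_ne_zero {ι : Type*} [Fintype ι] [DecidableEq ι] {A E : Matrix ι ι ℂ}
    (h : IsUnit E.det) : (pencil A E).det ≠ 0 := by
  have h1 : pencil A E = -(constPoly E * (E⁻¹ * A).charmatrix) := by
    have : (E⁻¹ * A).charmatrix = -pencil (E⁻¹ * A) 1 := by
      ext1 i j
      by_cases hij : i = j
      · subst hij
        simp [pencil_apply]
      · simp [pencil_apply, hij]
    rw [this, Matrix.mul_neg, neg_neg, mul_pencil, Matrix.mul_nonsing_inv_cancel_left _ _ h,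
      Matrix.mul_one]
  have h2 : (constPoly E).det = C E.det := (RingHom.map_det (C : ℂ →+* ℂ[X]) E).symm
  rw [h1, Matrix.det_neg, Matrix.det_mul, h2]
  refine mul_ne_zero (pow_ne_zero _ (by simp)) (mul_ne_zero ?_ ?_)
  · rw [Ne, C_eq_zero]
    exact h.ne_zero
  · exact (Matrix.charpoly_monic (E⁻¹ * A)).ne_zero

theorem evalAt_leftBlock (S : Staircase m n d) (μ : ℂ) :
    evalAt (fromBlocks (pencil S.A₃₃ S.E₃₃) (pencil S.A₃₄ S.E₃₄) 0 (constPoly S.C₄)) μ =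
      fromBlocks S.A₃₃ S.A₃₄ 0 S.C₄ - μ • fromBlocks S.E₃₃ S.E₃₄ 0 0 := by
  rw [← evalAt_pencil, pencil_fromBlocks, pencil_zero_right, pencil_zero_right, constPoly_zero]

/-- The number of right Kronecker blocks is the dimension of the right null space: over the rational
functions, `ker P` and `ker (A₁₁ - λ E₁₁)` both correspond to the null space of the pencil. -/
theorem Staircase.right_count_eq {S : Staircase m n d} {P : Matrix (Fin m) (Fin n) ℂ[X]}
    (hd : ∀ i j, (P i j).natDegree ≤ d) (hr : normalRank P = r)
    (hQ : S.Q * S.Qᴴ = 1) (hZ : S.Zᴴ * S.Z = 1) (hZ' : S.Z * S.Zᴴ = 1)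
    (htop : pencil (S.Qᴴ * topA n d * S.Z) (S.Qᴴ * topE n d * S.Z) = S.top)
    (hbot : coeffRow d P * S.Z = S.bottom)
    (hright : OnlyRightKronecker S.A₁₁ S.E₁₁) (hfin : IsUnit S.E₂₂.det)
    (hleft : OnlyInfiniteAndLeftKronecker
      (fromBlocks S.A₃₃ S.A₃₄ 0 S.C₄) (fromBlocks S.E₃₃ S.E₃₄ 0 0)) :
    S.b₁ + r = S.a₁ + n := by
  let f : ℂ[X] →+* RatFunc ℂ := algebraMap ℂ[X] (RatFunc ℂ)
  have hf : Function.Injective f := IsFractionRing.injective ℂ[X] (RatFunc ℂ)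
  have mapone : ∀ {α : Type} [DecidableEq α], (1 : Matrix α α ℂ[X]).map f = 1 := fun {α} _ =>
    Matrix.map_one f (map_zero f) (map_one f)
  have mapzero : ∀ {α β : Type}, (0 : Matrix α β ℂ[X]).map f = 0 := fun {α β} =>
    Matrix.map_zero f (map_zero f)
  -- the linearization over the rational functions
  let T := (pencil (topA n d) (topE n d)).map f
  let Cr := (constPoly (coeffRow d P)).map f
  let Lam := (monomialCol n d).map f
  let R := (constPoly (lastRow n d)).map f
  have hTL : T * Lam = 0 := by
    rw [← Matrix.map_mul, topPencil_mul_monomialCol, mapzero]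
  have hRL : R * Lam = 1 := by
    rw [← Matrix.map_mul, lastRow_mul_monomialCol, mapone]
  have hCL : Cr * Lam = P.map f := by
    rw [← Matrix.map_mul, coeffRow_mul_monomialCol hd]
  have hTx : ∀ x, T *ᵥ x = 0 → x = Lam *ᵥ (R *ᵥ x) := by
    intro x hx
    have h1 : (sysInvLeft n d).map f * T + Lam * R = 1 := by
      have := inverse_mul_pencil_sys (n := n) (d := d)
      rw [pencil_sys, Matrix.fromCols_mul_fromRows] at this
      have := congrArg (fun Y => Y.map f) this
      simpa [T, Lam, R, Matrix.map_add _ (map_add f), Matrix.map_mul, mapone] using this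
    have h2 := congrArg (· *ᵥ x) h1
    simp only [Matrix.add_mulVec, ← Matrix.mulVec_mulVec, hx, Matrix.mulVec_zero, zero_add,
      Matrix.one_mulVec] at h2
    exact h2.symm
  -- the unitary transformations over the rational functions
  let Zf := (constPoly S.Z).map f
  let Zi := (constPoly S.Zᴴ).map f
  have hZf : Zi * Zf = 1 := by
    rw [← Matrix.map_mul, ← constPoly_mul, hZ, constPoly_one, mapone]
  have hZf' : Zf * Zi = 1 := by
    rw [← Matrix.map_mul, ← constPoly_mul, hZ', constPoly_one, mapone]
  have hTZ : ∀ y, T *ᵥ (Zf *ᵥ y) = 0 ↔ S.top.map f *ᵥ y = 0 := by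
    have h1 : S.top.map f = (constPoly S.Qᴴ).map f * (T * Zf) := by
      rw [← htop, ← pencil_mul, ← mul_pencil, Matrix.mul_assoc, Matrix.map_mul, Matrix.map_mul]
    have h2 : (constPoly S.Q).map f * (constPoly S.Qᴴ).map f = 1 := by
      rw [← Matrix.map_mul, ← constPoly_mul, hQ, constPoly_one, mapone]
    intro y
    rw [h1, ← Matrix.mulVec_mulVec, ← Matrix.mulVec_mulVec]
    refine ⟨fun h => by rw [h, Matrix.mulVec_zero], fun h => ?_⟩
    rw [← Matrix.one_mulVec (T *ᵥ _), ← h2, ← Matrix.mulVec_mulVec, h, Matrix.mulVec_zero]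
  have hCZ : ∀ y, Cr *ᵥ (Zf *ᵥ y) = (constPoly S.bottom).map f *ᵥ y := by
    intro y
    rw [Matrix.mulVec_mulVec, ← Matrix.map_mul, ← constPoly_mul, hbot]
  -- the null space of the staircase form
  let A1 := (pencil S.A₁₁ S.E₁₁).map f
  obtain ⟨L, hL⟩ := exists_left_inverse
    (M := fromBlocks (pencil S.A₃₃ S.E₃₃) (pencil S.A₃₄ S.E₃₄) 0 (constPoly S.C₄)) fun μ => by
      rw [evalAt_leftBlock]
      exact hleft μ
  have hnull : ∀ y, S.top.map f *ᵥ y = 0 → (constPoly S.bottom).map f *ᵥ y = 0 →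
      y ∘ Sum.inr = 0 ∧ A1 *ᵥ (y ∘ Sum.inl) = 0 := by
    intro y h1 h2
    rw [S.top_map_mulVec] at h1
    rw [S.bottom_map_mulVec] at h2
    have hrow3 := funext fun i => congrFun h1 (Sum.inr (Sum.inr i))
    have hrow2 := funext fun i => congrFun h1 (Sum.inr (Sum.inl i))
    have hrow1 := funext fun i => congrFun h1 (Sum.inl i)
    have h34 : y ∘ Sum.inr ∘ Sum.inr = 0 := by
      have h3 : (fromBlocks (pencil S.A₃₃ S.E₃₃) (pencil S.A₃₄ S.E₃₄) 0 (constPoly S.C₄)).map f *ᵥ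
          (y ∘ Sum.inr ∘ Sum.inr) = 0 := by
        rw [Matrix.fromBlocks_map, Matrix.fromBlocks_mulVec, mapzero, Matrix.zero_mulVec, zero_add]
        ext (i | i)
        · exact congrFun hrow3 i
        · exact congrFun h2 i
      rw [← Matrix.one_mulVec (y ∘ _), ← mapone, ← hL, Matrix.map_mul, ← Matrix.mulVec_mulVec, h3,
        Matrix.mulVec_zero]
    have h3 : y ∘ Sum.inr ∘ Sum.inr ∘ Sum.inl = 0 := funext fun i => congrFun h34 (Sum.inl i)
    have h4 : y ∘ Sum.inr ∘ Sum.inr ∘ Sum.inr = 0 := funext fun i => congrFun h34 (Sum.inr i)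
    simp only [h3, h4, Sum.elim_inl, Sum.elim_inr, Matrix.mulVec_zero, add_zero,
      Pi.zero_apply] at hrow1 hrow2
    have h5 : y ∘ Sum.inr ∘ Sum.inl = 0 := by
      refine Matrix.eq_zero_of_mulVec_eq_zero ?_ hrow2
      have : ((pencil S.A₂₂ S.E₂₂).map f).det = f (pencil S.A₂₂ S.E₂₂).det :=
        (RingHom.map_det f _).symm
      rw [this, Ne, map_eq_zero_iff f hf]
      exact det_pencil_ne_zero hfin
    simp only [h5, Matrix.mulVec_zero, add_zero] at hrow1
    refine ⟨?_, hrow1⟩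
    ext (i | i)
    · exact congrFun h5 i
    · exact congrFun h34 i
  let g := (Zf.submatrix id Sum.inl).mulVecLin
  have hg : ∀ u, g u = Zf *ᵥ Sum.elim u 0 := by
    intro u
    ext i
    simp [g, Matrix.mulVec, dotProduct, Fintype.sum_sum_type]
  have hginj : Function.Injective g := by
    rw [← LinearMap.ker_eq_bot, LinearMap.ker_eq_bot']
    intro u hu
    rw [hg] at hu
    have h1 := congrArg (Zi *ᵥ ·) hu
    simp only [Matrix.mulVec_mulVec, hZf, Matrix.one_mulVec, Matrix.mulVec_zero] at h1
    exact funext fun i => congrFun h1 (Sum.inl i)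
  have hLinj : Function.Injective Lam.mulVecLin := by
    rw [← LinearMap.ker_eq_bot, LinearMap.ker_eq_bot']
    intro u hu
    have h1 := congrArg (R *ᵥ ·) (show Lam *ᵥ u = 0 from hu)
    simpa only [Matrix.mulVec_mulVec, hRL, Matrix.one_mulVec, Matrix.mulVec_zero] using h1
  have heq : (LinearMap.ker (P.map f).mulVecLin).map Lam.mulVecLin =
      (LinearMap.ker A1.mulVecLin).map g := by
    ext x
    trans T *ᵥ x = 0 ∧ Cr *ᵥ x = 0
    · constructor
      · rintro ⟨v, hv, rfl⟩
        have hv' : P.map f *ᵥ v = 0 := hv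
        rw [Matrix.mulVecLin_apply, Matrix.mulVec_mulVec, Matrix.mulVec_mulVec, hTL, hCL, hv',
          Matrix.zero_mulVec]
        exact ⟨rfl, rfl⟩
      · rintro ⟨h1, h2⟩
        refine ⟨R *ᵥ x, ?_, (hTx x h1).symm⟩
        change P.map f *ᵥ (R *ᵥ x) = 0
        rw [← hCL, ← Matrix.mulVec_mulVec, ← hTx x h1, h2]
    · constructor
      · rintro ⟨h1, h2⟩
        have hx : x = Zf *ᵥ (Zi *ᵥ x) := by rw [Matrix.mulVec_mulVec, hZf', Matrix.one_mulVec]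
        rw [hx, hTZ] at h1
        rw [hx, hCZ] at h2
        obtain ⟨h3, h4⟩ := hnull _ h1 h2
        refine ⟨(Zi *ᵥ x) ∘ Sum.inl, h4, ?_⟩
        rw [hg]
        conv_rhs => rw [hx]
        congr 1
        ext (i | i)
        · rfl
        · exact (congrFun h3 i).symm
      · rintro ⟨u, hu, rfl⟩
        have hu' : A1 *ᵥ u = 0 := hu
        rw [hg, hTZ, hCZ, S.top_map_mulVec, S.bottom_map_mulVec]
        have e1 : (Sum.elim u (0 : Fin S.a₂ ⊕ Fin S.b₃ ⊕ Fin S.b₄ → RatFunc ℂ)) ∘ Sum.inl = u := rfl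
        have e2 : ∀ {α : Type} (s : α → Fin S.a₂ ⊕ Fin S.b₃ ⊕ Fin S.b₄),
          (Sum.elim u (0 : Fin S.a₂ ⊕ Fin S.b₃ ⊕ Fin S.b₄ → RatFunc ℂ)) ∘ Sum.inr ∘ s = 0 :=
            fun s => rfl
        rw [e1, e2, e2, e2, hu']
        simp
  have hdim := (Submodule.equivMapOfInjective _ hLinj (LinearMap.ker (P.map f).mulVecLin)).finrank_eq
  rw [heq, ← (Submodule.equivMapOfInjective _ hginj _).finrank_eq] at hdim
  have hP := LinearMap.finrank_range_add_finrank_ker (P.map f).mulVecLin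
  have hA := LinearMap.finrank_range_add_finrank_ker A1.mulVecLin
  rw [Module.finrank_fintype_fun_eq_card, Fintype.card_fin] at hP hA
  have hP' : Module.finrank (RatFunc ℂ) (LinearMap.range (P.map f).mulVecLin) = r := hr
  have hA' : Module.finrank (RatFunc ℂ) (LinearMap.range A1.mulVecLin) = S.a₁ := by
    obtain ⟨Y, hY⟩ := exists_right_inverse (M := pencil S.A₁₁ S.E₁₁) fun μ => by
      rw [evalAt_pencil]
      exact hright.1 μ
    have := (Matrix.rank_eq_card_rows_iff A1).2 fun w => ⟨Y.map f *ᵥ w, by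
      rw [Matrix.mulVec_mulVec, ← Matrix.map_mul, hY, mapone, Matrix.one_mulVec]⟩
    rwa [Fintype.card_fin] at this
  omega

end Count

/-! ### Existence of the staircase form -/

section Existence

variable {m n d r : ℕ}

theorem exists_isDecomposition {P : Matrix (Fin m) (Fin n) ℂ[X]}
    (hd : ∀ i j, (P i j).natDegree ≤ d) (hr : normalRank P = r) :
    ∃ S : Staircase m n d, S.IsDecomposition P r := by
  obtain ⟨a₁, a₂, a₃, b₁, b₃, b₄, Q, Z, hQ, hZ, hA1, hE1, hA2, hE2, hEs, hμs, hE22, hl, hC⟩ :=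
    exists_adapted_unitary (topA n d) (topE n d) (coeffRow d P)
  set MA := Qᴴ * topA n d * Z
  set ME := Qᴴ * topE n d * Z
  set MC := coeffRow d P * Z
  let S : Staircase m n d :=
    { a₁ := a₁, a₂ := a₂, a₃ := a₃, b₁ := b₁, b₃ := b₃, b₄ := b₄, Q := Q, Z := Z
      A₁₁ := MA.submatrix Sum.inl Sum.inl
      E₁₁ := ME.submatrix Sum.inl Sum.inl
      A₁₂ := MA.submatrix Sum.inl (Sum.inr ∘ Sum.inl)
      E₁₂ := ME.submatrix Sum.inl (Sum.inr ∘ Sum.inl)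
      A₁₃ := MA.submatrix Sum.inl (Sum.inr ∘ Sum.inr ∘ Sum.inl)
      E₁₃ := ME.submatrix Sum.inl (Sum.inr ∘ Sum.inr ∘ Sum.inl)
      A₁₄ := MA.submatrix Sum.inl (Sum.inr ∘ Sum.inr ∘ Sum.inr)
      E₁₄ := ME.submatrix Sum.inl (Sum.inr ∘ Sum.inr ∘ Sum.inr)
      A₂₂ := MA.submatrix (Sum.inr ∘ Sum.inl) (Sum.inr ∘ Sum.inl)
      E₂₂ := ME.submatrix (Sum.inr ∘ Sum.inl) (Sum.inr ∘ Sum.inl)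
      A₂₃ := MA.submatrix (Sum.inr ∘ Sum.inl) (Sum.inr ∘ Sum.inr ∘ Sum.inl)
      E₂₃ := ME.submatrix (Sum.inr ∘ Sum.inl) (Sum.inr ∘ Sum.inr ∘ Sum.inl)
      A₂₄ := MA.submatrix (Sum.inr ∘ Sum.inl) (Sum.inr ∘ Sum.inr ∘ Sum.inr)
      E₂₄ := ME.submatrix (Sum.inr ∘ Sum.inl) (Sum.inr ∘ Sum.inr ∘ Sum.inr)
      A₃₃ := MA.submatrix (Sum.inr ∘ Sum.inr) (Sum.inr ∘ Sum.inr ∘ Sum.inl)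
      E₃₃ := ME.submatrix (Sum.inr ∘ Sum.inr) (Sum.inr ∘ Sum.inr ∘ Sum.inl)
      A₃₄ := MA.submatrix (Sum.inr ∘ Sum.inr) (Sum.inr ∘ Sum.inr ∘ Sum.inr)
      E₃₄ := ME.submatrix (Sum.inr ∘ Sum.inr) (Sum.inr ∘ Sum.inr ∘ Sum.inr)
      C₄ := MC.submatrix id (Sum.inr ∘ Sum.inr ∘ Sum.inr) }
  have entry : ∀ {α β : Type} [Fintype β] [DecidableEq β] (M : Matrix α β ℂ) (i : α) (j : β),
      M i j = (M *ᵥ Pi.single j 1) i := fun M i j => by rw [Matrix.mulVec_single_one]; rfl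
  have single_inl : ∀ {α β : Type} [DecidableEq α] [DecidableEq β] (j : α),
      (Pi.single (Sum.inl j) 1 : α ⊕ β → ℂ) ∘ Sum.inr = 0 := fun j => by ext i; simp
  have single_inr_inl : ∀ {α β γ : Type} [DecidableEq α] [DecidableEq β] [DecidableEq γ] (j : β),
      (Pi.single (Sum.inr (Sum.inl j)) 1 : α ⊕ β ⊕ γ → ℂ) ∘ Sum.inr ∘ Sum.inr = 0 :=
    fun j => by ext i; simp
  have hzA1 : ∀ i j, MA (Sum.inr i) (Sum.inl j) = 0 := fun i j =>
    (entry MA _ _).trans (congrFun (hA1 _ (single_inl j)) i)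
  have hzE1 : ∀ i j, ME (Sum.inr i) (Sum.inl j) = 0 := fun i j =>
    (entry ME _ _).trans (congrFun (hE1 _ (single_inl j)) i)
  have hzA2 : ∀ i j, MA (Sum.inr (Sum.inr i)) (Sum.inr (Sum.inl j)) = 0 := fun i j =>
    (entry MA _ _).trans (congrFun (hA2 _ (single_inr_inl j)) i)
  have hzE2 : ∀ i j, ME (Sum.inr (Sum.inr i)) (Sum.inr (Sum.inl j)) = 0 := fun i j =>
    (entry ME _ _).trans (congrFun (hE2 _ (single_inr_inl j)) i)
  have hzC : ∀ i j, (Pi.single j 1 : _ → ℂ) ∘ Sum.inr ∘ Sum.inr ∘ Sum.inr = 0 →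
      MC i j = 0 := fun i j h => (entry MC _ _).trans (congrFun ((hC _).2 h) i)
  have htop : pencil MA ME = S.top := by
    ext1 i j
    rcases i with i | i | i <;> rcases j with j | j | j | j <;>
    simp [S, Staircase.top, pencil_apply, hzA1, hzE1, hzA2, hzE2]
  have hbot : MC = S.bottom := by
    ext i (j | j | j | j)
    · exact hzC _ _ (by ext k; simp)
    · exact hzC _ _ (by ext k; simp)
    · exact hzC _ _ (by ext k; simp)
    · rfl
  have hright : OnlyRightKronecker S.A₁₁ S.E₁₁ := by
    have hsub : ∀ (M : Matrix (Fin a₁ ⊕ Fin a₂ ⊕ Fin a₃) (Fin b₁ ⊕ Fin a₂ ⊕ Fin b₃ ⊕ Fin b₄) ℂ),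
        (∀ w, w ∘ Sum.inr = 0 → ∃ x, x ∘ Sum.inr = 0 ∧ M *ᵥ x = w) →
        FullRowRank (M.submatrix Sum.inl Sum.inl) := by
      intro M hM
      rw [fullRowRank_iff]
      intro w
      obtain ⟨x, hx, hxw⟩ := hM (Sum.elim w 0) rfl
      refine ⟨x ∘ Sum.inl, ?_⟩
      ext i
      have h1 := congrFun hxw (Sum.inl i)
      have h2 : ∀ j, x (Sum.inr j) = 0 := congrFun hx
      simp only [Matrix.mulVec, dotProduct, Fintype.sum_sum_type, h2, mul_zero,
        Finset.sum_const_zero, add_zero, Sum.elim_inl] at h1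
      exact h1
    exact ⟨fun μ => hsub (MA - μ • ME) (hμs μ), hsub ME hEs⟩
  have hfin : IsUnit S.E₂₂.det := by
    rw [← Matrix.isUnit_iff_isUnit_det, ← Matrix.mulVec_injective_iff_isUnit]
    have : Function.Injective S.E₂₂.mulVecLin := by
      rw [← LinearMap.ker_eq_bot, LinearMap.ker_eq_bot']
      intro u hu
      let x : Fin b₁ ⊕ Fin a₂ ⊕ Fin b₃ ⊕ Fin b₄ → ℂ := Sum.elim 0 (Sum.elim u 0)
      have h1 := hE22 x rfl (by
        ext (i | i)
        · refine Eq.trans ?_ (congrFun hu i)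
          simp [x, S, Matrix.mulVec, dotProduct, Fintype.sum_sum_type]
        · exact congrFun (hE2 x rfl) i)
      exact funext fun i => congrFun h1 (Sum.inl i)
    exact this
  have hfull : FullColRank S.C₄ := by
    rw [fullColRank_iff]
    intro u hu
    let x : Fin b₁ ⊕ Fin a₂ ⊕ Fin b₃ ⊕ Fin b₄ → ℂ := Sum.elim 0 (Sum.elim 0 (Sum.elim 0 u))
    refine (hC x).1 ?_
    rw [← hu]
    ext i
    simp [x, S, Matrix.mulVec, dotProduct, Fintype.sum_sum_type]
  have hleft : OnlyInfiniteAndLeftKronecker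
      (fromBlocks S.A₃₃ S.A₃₄ 0 S.C₄) (fromBlocks S.E₃₃ S.E₃₄ 0 0) := by
    intro μ
    rw [fullColRank_iff]
    intro u hu
    have hu4 : u ∘ Sum.inr = 0 := by
      refine (fullColRank_iff _).1 hfull _ (funext fun i => ?_)
      have := congrFun hu (Sum.inr i)
      simpa [Matrix.mulVec, dotProduct, Fintype.sum_sum_type] using this
    let x : Fin b₁ ⊕ Fin a₂ ⊕ Fin b₃ ⊕ Fin b₄ → ℂ := Sum.elim 0 (Sum.elim 0 u)
    refine hl μ x hu4 (funext fun i => ?_)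
    have := congrFun hu (Sum.inl i)
    rw [Pi.zero_apply] at this ⊢
    rw [← this]
    simp [x, S, Matrix.mulVec, dotProduct, Fintype.sum_sum_type]
  exact ⟨S, hQ, hZ, (S.form_iff P).2 ⟨htop, hbot⟩, hright,
    Staircase.right_count_eq hd hr hQ.2 hZ.1 hZ.2 htop hbot hright hfin hleft, hfin, hleft, hfull⟩

end Existence

/-! ### Feedbacks and the factorization they give -/

section Feedback

variable {m n d r : ℕ}

theorem Matrix.card_eq_of_mul_eq_one {R ι κ : Type*} [CommRing R] [Nontrivial R] [Fintype ι]
    [Fintype κ] [DecidableEq ι] [DecidableEq κ] {M : Matrix ι κ R} {N : Matrix κ ι R}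
    (h₁ : M * N = 1) (h₂ : N * M = 1) : Fintype.card ι = Fintype.card κ := by
  simpa using (Matrix.toLin'OfInv h₁ h₂).finrank_eq

theorem selRow_mul_stackRows {κ : Type*} (h : r ≤ n) (T : Matrix (Fin r) κ ℂ)
    (B : Matrix (Fin (n - r)) κ ℂ) : selRow r n * stackRows T B = T := by
  ext i j
  rw [Matrix.mul_apply, Finset.sum_eq_single (Fin.castLE h i)]
  · simp [selRow, stackRows]
  · intro b _ hb
    have : ¬ (i : ℕ) = b := fun h' => hb (Fin.ext h'.symm)
    simp [selRow, this]
  · simp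

theorem sysLeft_mul_systemMatrix_mul_sysRight {S : Staircase m n d} (K : S.Feedback r)
    (P : Matrix (Fin m) (Fin n) ℂ[X]) :
    constPoly S.sysLeft * systemMatrix (sysA n d) (sysE n d) (sysB n d) (coeffRow d P) 0 *
        constPoly K.sysRight =
      fromBlocks
        (fromRows (pencil (S.Qᴴ * topA n d * S.Z) (S.Qᴴ * topE n d * S.Z))
          (constPoly (lastRow n d * S.Z - K.F * S.Z)))
        (fromRows 0 (-1)) (constPoly (coeffRow d P * S.Z)) 0 := by
  have h1 : constPoly (S.leftQ n) * pencil (sysA n d) (sysE n d) =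
      fromRows (constPoly S.Qᴴ * pencil (topA n d) (topE n d)) (constPoly (lastRow n d)) := by
    rw [pencil_sys, Staircase.leftQ, constPoly_fromBlocks, Matrix.fromBlocks_mul_fromRows]
    simp [constPoly_zero, constPoly_one]
  have h2 : constPoly (S.leftQ n) * constPoly (sysB n d) = fromRows 0 (-1) := by
    rw [sysB, Staircase.leftQ, constPoly_fromBlocks, constPoly_fromRows,
      Matrix.fromBlocks_mul_fromRows]
    simp [constPoly_zero, constPoly_one, constPoly_neg]
  rw [Staircase.sysLeft, systemMatrix, Staircase.Feedback.sysRight, constPoly_fromBlocks,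
    constPoly_fromBlocks, Matrix.fromBlocks_multiply, Matrix.fromBlocks_multiply, h1, h2]
  simp only [constPoly_zero, constPoly_one, Matrix.zero_mul, Matrix.mul_zero, Matrix.one_mul,
    Matrix.mul_one, add_zero, zero_add]
  congr 1
  · rw [Matrix.fromRows_mul, Matrix.fromRows_mul, mul_pencil, pencil_mul, Matrix.zero_mul,
      ← constPoly_mul, Matrix.neg_mul, Matrix.one_mul]
    ext1 i j
    rcases i with i | i
    · simp
    · simp [sub_eq_add_neg, constPoly, -Matrix.map_mul]
  · rw [constPoly_mul]

theorem Staircase.Feedback.isEmbedding_iff {S : Staircase m n d} {P : Matrix (Fin m) (Fin n) ℂ[X]}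
    (hS : S.IsDecomposition P r) (K : S.Feedback r) :
    K.IsEmbedding P ↔ lastRow n d * S.Z - K.F * S.Z = K.rows ∧
      IsUnimodular (fromRows (pencil S.A₁₁ S.E₁₁) (constPoly K.Z₁)) ∧
      IsUnimodular (fromBlocks (pencil S.A₃₃ S.E₃₃) (pencil S.A₃₄ S.E₃₄)
        (constPoly K.Z₃) (constPoly K.Z₄)) := by
  obtain ⟨htop, hbot⟩ := (S.form_iff P).1 hS.form
  have key : constPoly S.sysLeft *
        systemMatrix (sysA n d) (sysE n d) (sysB n d) (coeffRow d P) 0 * constPoly K.sysRight =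
      fromBlocks (fromRows S.top (constPoly K.rows)) (fromRows 0 (-1)) (constPoly S.bottom) 0 ↔
      lastRow n d * S.Z - K.F * S.Z = K.rows := by
    rw [sysLeft_mul_systemMatrix_mul_sysRight, htop, hbot, Matrix.fromBlocks_inj,
      Matrix.fromRows_ext_iff, constPoly_injective.eq_iff]
    simp
  exact ⟨fun h => ⟨key.1 h.form, h.unimodular₁, h.unimodular₃⟩,
    fun h => ⟨key.2 h.1, h.2.1, h.2.2⟩⟩

/-- The last diagonal block of the staircase form inherits full row rank from
the first block rows of the linearization. -/
theorem fullRowRank_last {S : Staircase m n d} {P : Matrix (Fin m) (Fin n) ℂ[X]}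
    (hS : S.IsDecomposition P r) (μ : ℂ) :
    FullRowRank (fromCols S.A₃₃ S.A₃₄ - μ • fromCols S.E₃₃ S.E₃₄) := by
  rw [fullRowRank_iff]
  intro w
  let w' : Fin S.a₁ ⊕ Fin S.a₂ ⊕ Fin S.a₃ → ℂ := Sum.elim 0 (Sum.elim 0 w)
  let y := S.Zᴴ *ᵥ (evalAt (sysInvLeft n d) μ *ᵥ (S.Q *ᵥ w'))
  have h1 : evalAt S.top μ *ᵥ y = w' := by
    obtain ⟨htop, -⟩ := (S.form_iff P).1 hS.form
    rw [← htop, ← pencil_mul, ← mul_pencil, evalAt_mul, evalAt_mul, evalAt_constPoly,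
      evalAt_constPoly]
    simp only [y, Matrix.mulVec_mulVec]
    rw [show S.Qᴴ * evalAt (pencil (topA n d) (topE n d)) μ * S.Z *
        (S.Zᴴ * evalAt (sysInvLeft n d) μ * S.Q) = S.Qᴴ *
          (evalAt (pencil (topA n d) (topE n d)) μ * (S.Z * S.Zᴴ) * evalAt (sysInvLeft n d) μ) *
            S.Q by simp only [Matrix.mul_assoc], hS.unitaryZ.2, Matrix.mul_one, ← evalAt_mul,
      topPencil_mul_sysInvLeft, evalAt_one, Matrix.mul_one, hS.unitaryQ.1, Matrix.one_mulVec]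
  have h2 : evalAt S.top μ *ᵥ y = _ := S.top_map_mulVec (evalRingHom μ) y
  refine ⟨y ∘ Sum.inr ∘ Sum.inr, ?_⟩
  rw [← evalAt_pencil, pencil_fromCols, evalAt_fromCols, Matrix.fromCols_mulVec]
  rw [h1] at h2
  exact funext fun i => (congrFun h2 (Sum.inr (Sum.inr i))).symm

theorem exists_isEmbedding {S : Staircase m n d} {P : Matrix (Fin m) (Fin n) ℂ[X]} (hrn : r ≤ n)
    (hS : S.IsDecomposition P r) : ∃ K : S.Feedback r, K.IsEmbedding P := by
  have hcQ := Matrix.card_eq_of_mul_eq_one hS.unitaryQ.1 hS.unitaryQ.2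
  have hcZ := Matrix.card_eq_of_mul_eq_one hS.unitaryZ.1 hS.unitaryZ.2
  simp only [Fintype.card_sum, Fintype.card_prod, Fintype.card_fin, add_mul, one_mul] at hcQ hcZ
  have hcount := hS.right_count
  obtain ⟨Z₁, hZ₁⟩ := exists_unimodular_completion (k := n - r) hS.right.1
    (by simp only [Fintype.card_fin]; omega)
  obtain ⟨Y, hY⟩ := exists_unimodular_completion (k := r) (fullRowRank_last hS)
    (by simp only [Fintype.card_fin, Fintype.card_sum]; omega)
  let K₀ : S.Feedback r := { Z₁ := Z₁, Z₃ := Y.toCols₁, Z₄ := Y.toCols₂, F := 0 }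
  let K : S.Feedback r := { K₀ with F := lastRow n d - K₀.rows * S.Zᴴ }
  refine ⟨K, (Staircase.Feedback.isEmbedding_iff hS K).2 ⟨?_, hZ₁, ?_⟩⟩
  · change lastRow n d * S.Z - (lastRow n d - K₀.rows * S.Zᴴ) * S.Z = K₀.rows
    rw [Matrix.sub_mul, Matrix.mul_assoc, hS.unitaryZ.1, Matrix.mul_one, sub_sub_cancel]
  · rw [← Matrix.fromCols_toCols Y, pencil_fromCols, constPoly_fromCols,
      Matrix.fromRows_fromCols_eq_fromBlocks] at hY
    exact hY

/-- The factorization `P = N G` given by a feedback, and a left inverse of `N`. In the coordinates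
of `Z`, the last two blocks `Y` of the monomial column satisfy `W Y = [0; G]` and `C₄ Y₄ = P`, where
`W` is the unimodular embedding, so that `P = [0, C₄] W⁻¹ [0; I] G`. The left inverse comes from one
of the pencil with left Kronecker blocks only. -/
theorem exists_factorization {S : Staircase m n d} {P : Matrix (Fin m) (Fin n) ℂ[X]}
    (hd : ∀ i j, (P i j).natDegree ≤ d) (hrn : r ≤ n) (hS : S.IsDecomposition P r)
    (K : S.Feedback r) (hK : K.IsEmbedding P) :
    ∃ (N : Matrix (Fin m) (Fin r) ℂ[X]) (G : Matrix (Fin r) (Fin n) ℂ[X])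
      (L : Matrix (Fin r) (Fin m) ℂ[X]),
      K.RealizesLeft N ∧ K.RealizesRight G ∧ P = N * G ∧ L * N = 1 := by
  obtain ⟨htop, hbot⟩ := (S.form_iff P).1 hS.form
  obtain ⟨hrows, -, V, hWV, hVW⟩ := (K.isEmbedding_iff hS).1 hK
  have hW : pencil (fromBlocks S.A₃₃ S.A₃₄ K.Z₃ K.Z₄) (fromBlocks S.E₃₃ S.E₃₄ 0 0) =
      fromBlocks (pencil S.A₃₃ S.E₃₃) (pencil S.A₃₄ S.E₃₄) (constPoly K.Z₃) (constPoly K.Z₄) := by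
    rw [pencil_fromBlocks, pencil_zero_right, pencil_zero_right]
  let J : Matrix (Fin S.a₃ ⊕ Fin r) (Fin r) ℂ[X] := fromRows 0 1
  let N := constPoly (fromCols (0 : Matrix (Fin m) (Fin S.b₃) ℂ) S.C₄) * V * J
  let G := constPoly (selRow r n) + constPoly (-(selRow r n * K.F)) * monomialCol n d
  have hN : K.RealizesLeft N := by
    have := isRealization_of_inverse (B := (fromRows 0 (-1) : Matrix _ (Fin r) ℂ))
      (C := fromCols (0 : Matrix (Fin m) (Fin S.b₃) ℂ) S.C₄) (D := 0)
      (by rw [hW]; exact hWV) (by rw [hW]; exact hVW)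
    have hB : constPoly (fromRows 0 (-1) : Matrix (Fin S.a₃ ⊕ Fin r) (Fin r) ℂ) = -J := by
      rw [constPoly_fromRows, constPoly_neg, constPoly_one, constPoly_zero]
      ext1 i j
      rcases i with i | i <;> simp [J]
    rw [hB, constPoly_zero, Matrix.mul_neg, sub_neg_eq_add, zero_add] at this
    exact this
  -- the block column of monomials in the coordinates of `Z`
  let lam := constPoly S.Zᴴ * monomialCol n d
  let Y := lam.submatrix (Sum.inr ∘ Sum.inr) id
  have hlam : constPoly S.Z * lam = monomialCol n d := by
    rw [← Matrix.mul_assoc, ← constPoly_mul, hS.unitaryZ.2, constPoly_one, Matrix.one_mul]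
  have hZlam : ∀ M : Matrix (Fin r) (Fin (d + 1) × Fin n) ℂ,
      constPoly (M * S.Z) * lam = constPoly M * monomialCol n d := fun M => by
    rw [constPoly_mul, Matrix.mul_assoc, hlam]
  have htoplam : S.top * lam = 0 := by
    rw [← htop, ← pencil_mul, ← mul_pencil, Matrix.mul_assoc, hlam, Matrix.mul_assoc,
      topPencil_mul_monomialCol, Matrix.mul_zero]
  have hY₁ : fromCols (pencil S.A₃₃ S.E₃₃) (pencil S.A₃₄ S.E₃₄) * Y = 0 := by
    ext1 i j
    have := congrFun (congrFun htoplam (Sum.inr (Sum.inr i))) j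
    simpa [Y, Matrix.mul_apply, Staircase.top, Fintype.sum_sum_type] using this
  have hY₂ : constPoly (fromCols K.Z₃ K.Z₄) * Y = G := by
    have h1 : selRow r n * K.rows = fromCols 0 (fromCols 0 (fromCols K.Z₃ K.Z₄)) :=
      selRow_mul_stackRows hrn _ _
    have h2 : G = constPoly (selRow r n * K.rows) * lam := by
      rw [← hrows, ← Matrix.sub_mul, ← Matrix.mul_assoc (selRow r n), hZlam, Matrix.mul_sub, sub_eq_add_neg]
      have : ∀ M M' : Matrix (Fin r) (Fin (d + 1) × Fin n) ℂ,
          constPoly (M + M') = constPoly M + constPoly M' := fun M M' => by ext; simp [constPoly]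
      rw [this, Matrix.add_mul, constPoly_mul _ (lastRow n d), Matrix.mul_assoc,
        lastRow_mul_monomialCol, Matrix.mul_one]
    rw [h2, h1]
    ext1 i j
    simp [Y, Matrix.mul_apply, Fintype.sum_sum_type, constPoly]
  have hY₃ : constPoly (fromCols (0 : Matrix (Fin m) (Fin S.b₃) ℂ) S.C₄) * Y = P := by
    rw [← coeffRow_mul_monomialCol hd, ← hlam, ← Matrix.mul_assoc, ← constPoly_mul, hbot]
    ext1 i j
    simp [Y, Staircase.bottom, Matrix.mul_apply, Fintype.sum_sum_type, constPoly]
  have hYV : Y = V * (J * G) := by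
    have h1 : fromBlocks (pencil S.A₃₃ S.E₃₃) (pencil S.A₃₄ S.E₃₄) (constPoly K.Z₃)
        (constPoly K.Z₄) * Y = J * G := by
      rw [← Matrix.fromRows_fromCols_eq_fromBlocks, Matrix.fromRows_mul, hY₁, ← constPoly_fromCols,
        hY₂, Matrix.fromRows_mul, Matrix.zero_mul, Matrix.one_mul]
    rw [← h1, ← Matrix.mul_assoc, hVW, Matrix.one_mul]
  -- the left inverse of `N`
  obtain ⟨L, hL⟩ := exists_left_inverse
    (M := fromBlocks (pencil S.A₃₃ S.E₃₃) (pencil S.A₃₄ S.E₃₄) 0 (constPoly S.C₄)) fun μ => by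
      rw [evalAt_leftBlock]
      exact hS.left μ
  have hWJ : fromRows (fromCols (pencil S.A₃₃ S.E₃₃) (pencil S.A₃₄ S.E₃₄))
      (fromCols (constPoly K.Z₃) (constPoly K.Z₄)) * (V * J) = J := by
    rw [Matrix.fromRows_fromCols_eq_fromBlocks, ← Matrix.mul_assoc, hWV, Matrix.one_mul]
  rw [Matrix.fromRows_mul, Matrix.fromRows_ext_iff] at hWJ
  let J' : Matrix (Fin S.a₃ ⊕ Fin m) (Fin m) ℂ[X] := fromRows 0 1
  have hLJ : V * J = L * (J' * N) := by
    have h1 : fromBlocks (pencil S.A₃₃ S.E₃₃) (pencil S.A₃₄ S.E₃₄) 0 (constPoly S.C₄) * (V * J) =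
        J' * N := by
      rw [← Matrix.fromRows_fromCols_eq_fromBlocks, Matrix.fromRows_mul, hWJ.1,
        Matrix.fromRows_mul, Matrix.zero_mul, Matrix.one_mul]
      simp only [N, constPoly_fromCols, constPoly_zero, Matrix.mul_assoc]
    rw [← h1, ← Matrix.mul_assoc L, hL, Matrix.one_mul]
  refine ⟨N, G, fromCols (constPoly K.Z₃) (constPoly K.Z₄) * L * J', hN,
    isRealization_sys _ _, ?_, ?_⟩
  · rw [← hY₃, hYV]
    simp only [N, Matrix.mul_assoc]
  · rw [Matrix.mul_assoc, Matrix.mul_assoc, ← hLJ, hWJ.2]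

end Feedback

/-! ### Consequences of a factorization with a left invertible factor -/

section Factor

variable {m n r : ℕ}

theorem eq_zero_of_mul_eq_zero_of_normalRank {ι : Type*} {M : Matrix ι (Fin r) ℂ[X]}
    {G : Matrix (Fin r) (Fin n) ℂ[X]} (hG : normalRank G = r) (h : M * G = 0) : M = 0 := by
  have hs := (Matrix.rank_eq_card_rows_iff (G.map (algebraMap ℂ[X] (RatFunc ℂ)))).1
    (hG.trans (Fintype.card_fin r).symm)
  have h' := congrArg (fun Y => Y.map (algebraMap ℂ[X] (RatFunc ℂ))) h
  simp only [Matrix.map_mul] at h'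
  rw [Matrix.map_zero _ (map_zero _)] at h'
  ext1 i j
  obtain ⟨v, hv⟩ := hs (Pi.single j 1)
  have h1 : M.map (algebraMap ℂ[X] (RatFunc ℂ)) *ᵥ Pi.single j 1 = 0 := by
    rw [← hv, Matrix.mulVec_mulVec, h', Matrix.zero_mulVec]
  rw [Matrix.mulVec_single_one] at h1
  have h2 : algebraMap ℂ[X] (RatFunc ℂ) (M i j) = 0 := congrFun h1 i
  exact (map_eq_zero_iff _ (IsFractionRing.injective ℂ[X] (RatFunc ℂ))).1 h2

/-- A left invertible matrix over a principal ideal domain is completed to an invertible one by a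
basis of the kernel of a left inverse. -/
theorem exists_unimodular_extension {N : Matrix (Fin m) (Fin r) ℂ[X]}
    {L : Matrix (Fin r) (Fin m) ℂ[X]} (h : L * N = 1) :
    ∃ hrm : r ≤ m, ∃ U : Matrix (Fin m) (Fin m) ℂ[X], IsUnimodular U ∧
      ∀ i j, U i (Fin.castLE hrm j) = N i j := by
  set f := Matrix.toLin' N with hf
  set g := Matrix.toLin' L with hg
  have hgf : ∀ x, g (f x) = x := fun x => by
    rw [hf, hg, Matrix.toLin'_apply, Matrix.toLin'_apply, Matrix.mulVec_mulVec, h,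
      Matrix.one_mulVec]
  let b := Module.finBasis ℂ[X] (LinearMap.ker g)
  have hmem : ∀ x, (LinearMap.id - f ∘ₗ g : (Fin m → ℂ[X]) →ₗ[ℂ[X]] _) x ∈ LinearMap.ker g :=
    fun x => by simp [hgf]
  let c := LinearMap.codRestrict (LinearMap.ker g) _ hmem
  have hc : ∀ x, (c x : Fin m → ℂ[X]) = x - f (g x) := fun x => rfl
  let t := (LinearMap.ker g).subtype ∘ₗ b.equivFun.symm.toLinearMap
  let t' := b.equivFun.toLinearMap ∘ₗ c
  have hgt : g ∘ₗ t = 0 := LinearMap.ext fun x => (b.equivFun.symm x).2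
  have ht'f : t' ∘ₗ f = 0 := by
    have : ∀ x, c (f x) = 0 := fun x => Subtype.ext (by rw [hc, hgf]; simp)
    exact LinearMap.ext fun x => by simp [t', this]
  have ht't : t' ∘ₗ t = LinearMap.id := by
    have : ∀ x, c (t x) = b.equivFun.symm x := fun x => Subtype.ext (by
      rw [hc, show g (t x) = 0 from LinearMap.congr_fun hgt x, map_zero, sub_zero]
      rfl)
    refine LinearMap.ext fun x => ?_
    simp only [t', LinearMap.comp_apply, this]
    exact b.equivFun.apply_symm_apply x
  have hsum : f ∘ₗ g + t ∘ₗ t' = LinearMap.id := by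
    refine LinearMap.ext fun x => ?_
    simp [t, t', hc]
  have hNf : LinearMap.toMatrix' f = N := LinearMap.toMatrix'_toLin' N
  have hLg : LinearMap.toMatrix' g = L := LinearMap.toMatrix'_toLin' L
  let B := fromCols N (LinearMap.toMatrix' t)
  let B' := fromRows L (LinearMap.toMatrix' t')
  have hBB' : B * B' = 1 := by
    rw [Matrix.fromCols_mul_fromRows, ← hNf, ← hLg, ← LinearMap.toMatrix'_comp,
      ← LinearMap.toMatrix'_comp, ← map_add, hsum, LinearMap.toMatrix'_id]
  have hB'B : B' * B = 1 := by
    rw [Matrix.fromRows_mul_fromCols, h, ← LinearMap.toMatrix'_comp t' t, ht't,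
      LinearMap.toMatrix'_id]
    nth_rw 1 [← hLg]
    rw [← hNf, ← LinearMap.toMatrix'_comp, ← LinearMap.toMatrix'_comp, hgt, ht'f, map_zero,
      map_zero, Matrix.fromBlocks_one]
  have hcard := Matrix.card_eq_of_mul_eq_one hBB' hB'B
  simp only [Fintype.card_sum, Fintype.card_fin] at hcard
  have hrm : r ≤ m := by omega
  let e := (finSumFinEquiv.trans (finCongr hcard.symm)).symm
  have he : ∀ j, e (Fin.castLE hrm j) = Sum.inl j := fun j => by
    rw [Equiv.symm_apply_eq]
    ext
    simp
  refine ⟨hrm, B.submatrix id e, ⟨B'.submatrix e id, ?_, ?_⟩, fun i j => ?_⟩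
  · rw [Matrix.submatrix_mul_equiv, hBB', Matrix.submatrix_id_id]
  · rw [← Matrix.submatrix_mul _ _ _ _ _ Function.bijective_id, hB'B, Matrix.submatrix_one_equiv]
  · simp [he, B]

theorem mul_diagRect_apply {ι : Type*} (hrm : r ≤ m) (s : Fin r → ℂ[X])
    (M : Matrix ι (Fin m) ℂ[X]) (i : ι) (j : Fin n) :
    (M * diagRect m n s) i j =
      if h : (j : ℕ) < r then M i ⟨j, h.trans_le hrm⟩ * s ⟨j, h⟩ else 0 := by
  rw [Matrix.mul_apply]
  split_ifs with h
  · rw [Finset.sum_eq_single ⟨j, h.trans_le hrm⟩]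
    · simp [diagRect, h]
    · intro b _ hb
      have : ¬ (b : ℕ) = j := fun h' => hb (Fin.ext h')
      simp [diagRect, this]
    · simp
  · refine Finset.sum_eq_zero fun b _ => ?_
    have : ¬ ((b : ℕ) = j ∧ (b : ℕ) < r) := fun h' => h (h'.1 ▸ h'.2)
    simp [diagRect, this]

theorem mul_diagRect_castLE {ι : Type*} (hrm : r ≤ m) (s : Fin r → ℂ[X])
    (M : Matrix ι (Fin m) ℂ[X]) :
    M * diagRect m n s = M.submatrix id (Fin.castLE hrm) * diagRect r n s := by
  ext1 i j
  rw [mul_diagRect_apply hrm, mul_diagRect_apply le_rfl]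
  rfl

variable {P : Matrix (Fin m) (Fin n) ℂ[X]} {N : Matrix (Fin m) (Fin r) ℂ[X]}
  {G : Matrix (Fin r) (Fin n) ℂ[X]} {L : Matrix (Fin r) (Fin m) ℂ[X]}

theorem rank_evalAt_mul_of_left_inverse (hL : L * N = 1) (G : Matrix (Fin r) (Fin n) ℂ[X]) (μ : ℂ) :
    (evalAt (N * G) μ).rank = (evalAt G μ).rank := by
  rw [evalAt_mul]
  exact Matrix.rank_mul_of_left_inverse (L := evalAt L μ) (by rw [← evalAt_mul, hL, evalAt_one]) _

theorem rank_evalAt_of_left_inverse (hL : L * N = 1) (μ : ℂ) : (evalAt N μ).rank = r := by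
  have := rank_evalAt_mul_of_left_inverse hL (1 : Matrix (Fin r) (Fin r) ℂ[X]) μ
  rwa [Matrix.mul_one, evalAt_one, Matrix.rank_one, Fintype.card_fin] at this

theorem isFiniteZero_iff_of_left_inverse (hL : L * N = 1) (hP : P = N * G) (μ : ℂ) :
    IsFiniteZero G μ ↔ IsFiniteZero P μ := by
  rw [IsFiniteZero, IsFiniteZero, hP, rank_evalAt_mul_of_left_inverse hL,
    normalRank_mul_of_left_inverse hL]

theorem isCompactGCRD_of_left_inverse (hL : L * N = 1) (hP : P = N * G) (hr : normalRank P = r)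
    {k : ℕ} (p : Fin m → Fin k) : IsCompactGCRD (rowBlocks P p) G := by
  refine ⟨⟨fun i => ⟨N.submatrix Subtype.val id, ?_⟩, fun q D hD => ?_⟩, ?_⟩
  · rw [rowBlocks, hP]
    rfl
  · choose Q hQ using hD
    let Q' : Matrix (Fin m) (Fin q) ℂ[X] := Matrix.of fun a => Q (p a) ⟨a, rfl⟩
    have hPQ : P = Q' * D := by
      ext1 a j
      exact congrFun (congrFun (hQ (p a)) ⟨a, rfl⟩) j
    refine ⟨L * Q', ?_⟩
    rw [Matrix.mul_assoc, ← hPQ, hP, ← Matrix.mul_assoc, hL, Matrix.one_mul]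
  · have h1 : compound (rowBlocks P p) = P.submatrix (Equiv.sigmaFiberEquiv p) (Equiv.refl _) := rfl
    rw [h1, normalRank, ← Matrix.submatrix_map, Matrix.rank_submatrix]
    exact hr

/-- Smith forms of `G` and of `P = N G` agree. For one direction `N` is completed to a unimodular
matrix. For the other, the Smith form of `P` gives a second factorization `P = N₂ G₂` of this kind,
and then `G = W G₂` with `W = L N₂` unimodular because `G` and `G₂` have full row rank. -/
theorem hasSmithForm_iff_of_left_inverse (hL : L * N = 1) (hP : P = N * G) (hr : normalRank P = r)
    (s : Fin r → ℂ[X]) : HasSmithForm G s ↔ HasSmithForm P s := by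
  constructor
  · rintro ⟨-, hrn, hmon, hdvd, U, V, hU, hV, hG⟩
    obtain ⟨U', hUU', hU'U⟩ := hU
    have hL' : (U' * L) * (N * U) = 1 := by
      rw [Matrix.mul_assoc, ← Matrix.mul_assoc L, hL, Matrix.one_mul, hU'U]
    obtain ⟨hrm, T, hT, hTN⟩ := exists_unimodular_extension hL'
    refine ⟨hrm, hrn, hmon, hdvd, T, V, hT, hV, ?_⟩
    have h1 : T.submatrix id (Fin.castLE hrm) = N * U := Matrix.ext hTN
    rw [mul_diagRect_castLE hrm, h1, hP, hG]
    simp only [Matrix.mul_assoc]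
  · rintro ⟨hrm, hrn, hmon, hdvd, U, V, ⟨U', hUU', hU'U⟩, hV, hPU⟩
    let N₂ := U.submatrix id (Fin.castLE hrm)
    let L₂ := U'.submatrix (Fin.castLE hrm) id
    let G₂ := diagRect r n s * V
    have hL₂ : L₂ * N₂ = 1 := by
      rw [← Matrix.submatrix_mul _ _ _ _ _ Function.bijective_id, hU'U]
      exact Matrix.submatrix_one _ (Fin.castLE_injective hrm)
    have hP₂ : P = N₂ * G₂ := by
      rw [hPU, mul_diagRect_castLE hrm, Matrix.mul_assoc]
    have h1 : G = L * N₂ * G₂ := by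
      rw [Matrix.mul_assoc, ← hP₂, hP, ← Matrix.mul_assoc, hL, Matrix.one_mul]
    have h2 : G₂ = L₂ * N * G := by
      rw [Matrix.mul_assoc, ← hP, hP₂, ← Matrix.mul_assoc, hL₂, Matrix.one_mul]
    have hGr : normalRank G = r := by
      rw [← normalRank_mul_of_left_inverse hL, ← hP, hr]
    have h3 : (L * N₂) * (L₂ * N) = 1 := by
      rw [← sub_eq_zero]
      refine eq_zero_of_mul_eq_zero_of_normalRank hGr ?_
      rw [Matrix.sub_mul, Matrix.one_mul, Matrix.mul_assoc, ← h2, ← h1, sub_self]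
    refine ⟨le_rfl, hrn, hmon, hdvd, L * N₂, V, ⟨L₂ * N, h3, _root_.mul_eq_one_comm.1 h3⟩, hV, ?_⟩
    rw [Matrix.mul_assoc]
    exact h1

end Factor

end
theorem theorem4p3 (m n d r : ℕ) (P : Matrix (Fin m) (Fin n) ℂ[X])
    (hd : ∀ i j, (P i j).natDegree ≤ d) (hr : normalRank P = r) :
    -- the system matrix of `P` is a realization of `P`
    IsRealization (sysA n d) (sysE n d) (sysB n d) (coeffRow d P) 0 P ∧
    -- staircase decompositions exist
    (∃ S : Staircase m n d, S.IsDecomposition P r) ∧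
    ∀ S : Staircase m n d, S.IsDecomposition P r →
      -- each of them admits a feedback
      (∃ K : S.Feedback r, K.IsEmbedding P) ∧
      ∀ K : S.Feedback r, K.IsEmbedding P →
        -- and each feedback yields the factorization
        ∃ (N : Matrix (Fin m) (Fin r) ℂ[X]) (G : Matrix (Fin r) (Fin n) ℂ[X]),
          K.RealizesLeft N ∧ K.RealizesRight G ∧
          P = N * G ∧
          (∀ μ : ℂ, (evalAt N μ).rank = r) ∧
          (∀ (k : ℕ) (p : Fin m → Fin k), IsCompactGCRD (rowBlocks P p) G) ∧
          -- `G` has the finite zeros of `P`, with the same multiplicities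
          (∀ μ : ℂ, IsFiniteZero G μ ↔ IsFiniteZero P μ) ∧
          (∀ s : Fin r → ℂ[X], HasSmithForm G s ↔ HasSmithForm P s) := by
  have hrn : r ≤ n := by
    rw [← hr]
    exact Matrix.rank_le_width _
  refine ⟨?_, exists_isDecomposition hd hr, fun S hS => ⟨exists_isEmbedding hrn hS, fun K hK => ?_⟩⟩
  · have := isRealization_sys (n := n) (d := d) (coeffRow d P) 0
    rwa [constPoly_zero, zero_add, coeffRow_mul_monomialCol hd] at this
  · obtain ⟨N, G, L, hN, hG, hP, hL⟩ := exists_factorization hd hrn hS K hK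
    exact ⟨N, G, hN, hG, hP, rank_evalAt_of_left_inverse hL,
      fun k p => isCompactGCRD_of_left_inverse hL hP hr p,
      isFiniteZero_iff_of_left_inverse hL hP, hasSmithForm_iff_of_left_inverse hL hP hr⟩
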